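/- Let $g:\mathbb{R}\to\mathbb{R}$ be smooth with $g(0)=1$, let $\omega\in\mathbb{R}$, and let $\phi=(v,u)$, with $v,u$ real-valued, be the profile of a solitary wave $\phi(x)e^{-i\omega t}$ of the nonlinear Dirac equation on the line; that is, $\phi\in H^1(\mathbb{R},\mathbb{C}^2)$ (represented by differentiable functions) and $$\omega v=u'+g(v^2-u^2)v,\qquad \omega u=-v'-g(v^2-u^2)u .$$ Write $g=g(v^2-u^2)$, $g'=g'(v^2-u^2)$, and consider in $L^2(\mathbb{R},\mathbb{C}^2)$, with domain $H^1(\mathbb{R},\mathbb{C}^2)$, the operators $$\mathscr{H}_-=\begin{pmatrix} g-\omega & \partial_x\\ -\partial_x & -g-\omega\end{pmatrix},\qquad \mathscr{H}_+=\begin{pmatrix} 2g'v^2+g-\omega & \partial_x-2g'vu\\ -\partial_x-2g'vu & 2g'u^2-g-\omega\end{pmatrix}.$$ Let $m_\pm=1\pm\omega$. Let the continuous (essential) spectrum of each of these operators be the set of all points of its spectrum that are not isolated eigenvalues of finite multiplicity. Then $$\sigma_{cont}(\mathscr{H}_+)=\sigma_{cont}(\mathscr{H}_-)=\mathbb{R}\setminus(-m_+,m_-)=\mathbb{R}\setminus(-(1+\omega),\,1-\omega).$$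 Moreover, the symbols $\sigma(\mathscr{H}_\pm)(x,\xi)$ (obtained by replacing $\partial_x$ by $i\xi$) satisfy $$\lim_{|x|\to\infty}\sigma(\mathscr{H}_\pm)(x,0)=\begin{pmatrix} m_- & 0\\ 0 & -m_+\end{pmatrix},$$ and the set of eigenvalues of this matrix consists of the gap edges $-m_+$ and $m_-$. -/

import Mathlib

open MeasureTheory TemperedDistribution Topology
open scoped LineDeriv SchwartzMap

noncomputable section

/-! ### Spectra of unbounded operators -/

namespace UnboundedOperator

variable {H : Type*} [NormedAddCommGroup H] [InnerProductSpace ℂ H]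

/-- The resolvent set of an unbounded operator `T`: the complex numbers `z` for which
`T - z : D(T) → H` is a bijection with bounded inverse `R`. -/
def resolventSet (T : H →ₗ.[ℂ] H) : Set ℂ :=
  {z | ∃ R : H →L[ℂ] H,
    (∀ y : H, ∃ h : R y ∈ T.domain, T ⟨R y, h⟩ - z • R y = y) ∧
    ∀ x : T.domain, R (T x - z • (x : H)) = x}

/-- The spectrum of an unbounded operator. -/
def spectrum (T : H →ₗ.[ℂ] H) : Set ℂ := (resolventSet T)ᶜ

/-- The kernel of `T - z`, as a subspace of the domain of `T`. -/
def eigenspace (T : H →ₗ.[ℂ] H) (z : ℂ) : Submodule ℂ T.domain :=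
  LinearMap.ker (T.toFun - z • T.domain.subtype)

/-- The discrete spectrum of a self-adjoint operator: the isolated points of the spectrum which
are eigenvalues of finite multiplicity. -/
def discreteSpectrum (T : H →ₗ.[ℂ] H) : Set ℂ :=
  {z | (∃ ε > 0, Metric.ball z ε ∩ spectrum T = {z}) ∧
    eigenspace T z ≠ ⊥ ∧ FiniteDimensional ℂ (eigenspace T z)}

/-- The essential spectrum of a self-adjoint operator: what remains of the spectrum when the
discrete spectrum is removed. -/
def essentialSpectrum (T : H →ₗ.[ℂ] H) : Set ℂ := spectrum T \ discreteSpectrum T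

end UnboundedOperator

/-! ### One-dimensional Dirac operators in `L²(ℝ, ℂ²)` -/

namespace Dirac

/-- Two-component spinors `ℂ²`. -/
abbrev Spinor : Type := EuclideanSpace ℂ (Fin 2)

/-- The Hilbert space `L²(ℝ, ℂ²)`. -/
abbrev L2Spinor : Type := Lp Spinor 2 (volume : Measure ℝ)

/-- The Sobolev space `H¹(ℝ, ℂ²)`, as a subspace of `L²(ℝ, ℂ²)`. -/
def sobolevH1 : Submodule ℂ L2Spinor where
  carrier := {ψ | MemSobolev 1 2 (ψ : 𝓢'(ℝ, Spinor))}
  add_mem' {ψ χ} hψ hχ := by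
    have h := MemSobolev.add hψ hχ
    simp only [← Lp.toTemperedDistributionCLM_apply, ← map_add] at h
    exact h
  zero_mem' := by
    have h := memSobolev_fun_zero ℝ Spinor 1 2
    rw [← map_zero (Lp.toTemperedDistributionCLM Spinor (volume : Measure ℝ) 2)] at h
    exact h
  smul_mem' c ψ hψ := by
    have h := MemSobolev.smul c hψ
    simp only [← Lp.toTemperedDistributionCLM_apply, ← map_smul] at h
    exact h

theorem toTemperedDistribution_injective :
    Function.Injective (fun ψ : L2Spinor => (ψ : 𝓢'(ℝ, Spinor))) := by
  intro ψ χ h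
  exact LinearMap.ker_eq_bot.mp
    (Lp.ker_toTemperedDistributionCLM_eq_bot (F := Spinor) (μ := (volume : Measure ℝ)) (p := 2)) h

theorem exists_deriv (ψ : sobolevH1) :
    ∃ η : L2Spinor, ∂_{(1 : ℝ)} ((ψ : L2Spinor) : 𝓢'(ℝ, Spinor)) = (η : 𝓢'(ℝ, Spinor)) := by
  have h := MemSobolev.lineDerivOp (m := (1 : ℝ)) ψ.2
  rw [sub_self] at h
  exact memSobolev_zero_iff.mp h

theorem deriv_add_aux {ψ χ η ζ θ : L2Spinor}
    (h1 : ∂_{(1 : ℝ)} (ψ : 𝓢'(ℝ, Spinor)) = (η : 𝓢'(ℝ, Spinor)))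
    (h2 : ∂_{(1 : ℝ)} (χ : 𝓢'(ℝ, Spinor)) = (ζ : 𝓢'(ℝ, Spinor)))
    (h3 : ∂_{(1 : ℝ)} ((ψ + χ : L2Spinor) : 𝓢'(ℝ, Spinor)) = (θ : 𝓢'(ℝ, Spinor))) :
    θ = η + ζ := by
  apply toTemperedDistribution_injective
  simp only [← Lp.toTemperedDistributionCLM_apply, map_add,
    LineDeriv.lineDerivOp_add] at h1 h2 h3 ⊢
  rw [← h3, h1, h2]

theorem deriv_smul_aux {c : ℂ} {ψ η θ : L2Spinor}
    (h1 : ∂_{(1 : ℝ)} (ψ : 𝓢'(ℝ, Spinor)) = (η : 𝓢'(ℝ, Spinor)))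
    (h3 : ∂_{(1 : ℝ)} ((c • ψ : L2Spinor) : 𝓢'(ℝ, Spinor)) = (θ : 𝓢'(ℝ, Spinor))) :
    θ = c • η := by
  apply toTemperedDistribution_injective
  simp only [← Lp.toTemperedDistributionCLM_apply, map_smul,
    LineDeriv.lineDerivOp_smul] at h1 h3 ⊢
  rw [← h3, h1]

/-- The distributional derivative `∂ₓ : H¹(ℝ, ℂ²) → L²(ℝ, ℂ²)`. -/
def derivH1 : sobolevH1 →ₗ[ℂ] L2Spinor where
  toFun ψ := (exists_deriv ψ).choose
  map_add' ψ χ := deriv_add_aux (exists_deriv ψ).choose_spec (exists_deriv χ).choose_spec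
    (exists_deriv (ψ + χ)).choose_spec
  map_smul' c ψ := deriv_smul_aux (exists_deriv ψ).choose_spec (exists_deriv (c • ψ)).choose_spec

/-- The defining property of `derivH1`. -/
theorem derivH1_spec (ψ : sobolevH1) :
    ∂_{(1 : ℝ)} ((ψ : L2Spinor) : 𝓢'(ℝ, Spinor)) = (derivH1 ψ : 𝓢'(ℝ, Spinor)) :=
  (exists_deriv ψ).choose_spec

/-- The coefficient matrix of `∂ₓ`. -/
def J₀ : Matrix (Fin 2) (Fin 2) ℂ := !![0, 1; -1, 0]

/-- The differential operator `ψ ↦ (∂ₓ ψ₂, -∂ₓ ψ₁)` with domain `H¹(ℝ, ℂ²)`. -/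
def kinetic : L2Spinor →ₗ.[ℂ] L2Spinor where
  domain := sobolevH1
  toFun := ((Matrix.toEuclideanCLM (𝕜 := ℂ) J₀).compLpL 2 (volume : Measure ℝ)).toLinearMap ∘ₗ
    derivH1

/-- The pointwise product `x ↦ V(x) ψ(x)`. -/
def mulFun (V : ℝ → Matrix (Fin 2) (Fin 2) ℂ) (ψ : L2Spinor) (x : ℝ) : Spinor :=
  Matrix.toEuclideanLin (V x) (ψ x)

theorem mulFun_add (V : ℝ → Matrix (Fin 2) (Fin 2) ℂ) (ψ χ : L2Spinor) :
    mulFun V (ψ + χ) =ᵐ[volume] mulFun V ψ + mulFun V χ := by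
  filter_upwards [Lp.coeFn_add ψ χ] with x hx
  rw [Pi.add_apply, mulFun, mulFun, mulFun, hx, Pi.add_apply, map_add]

theorem mulFun_smul (V : ℝ → Matrix (Fin 2) (Fin 2) ℂ) (c : ℂ) (ψ : L2Spinor) :
    mulFun V (c • ψ) =ᵐ[volume] c • mulFun V ψ := by
  filter_upwards [Lp.coeFn_smul c ψ] with x hx
  rw [Pi.smul_apply, mulFun, mulFun, hx, Pi.smul_apply, map_smul]

theorem mulFun_zero (V : ℝ → Matrix (Fin 2) (Fin 2) ℂ) :
    mulFun V 0 =ᵐ[volume] 0 := by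
  filter_upwards [Lp.coeFn_zero Spinor 2 (volume : Measure ℝ)] with x hx
  rw [mulFun, hx]
  exact map_zero _

/-- The maximal domain `{ψ ∈ L² | V ψ ∈ L²}` of the operator of multiplication by `V`. -/
def mulDomain (V : ℝ → Matrix (Fin 2) (Fin 2) ℂ) : Submodule ℂ L2Spinor where
  carrier := {ψ | MemLp (mulFun V ψ) 2 (volume : Measure ℝ)}
  add_mem' {ψ χ} hψ hχ := (MemLp.add hψ hχ).ae_eq (mulFun_add V ψ χ).symm
  zero_mem' := MemLp.zero.ae_eq (mulFun_zero V).symm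
  smul_mem' c ψ hψ := (MemLp.const_smul hψ c).ae_eq (mulFun_smul V c ψ).symm

theorem memLp_of_mem_mulDomain {V : ℝ → Matrix (Fin 2) (Fin 2) ℂ} (ψ : mulDomain V) :
    MemLp (mulFun V ψ) 2 (volume : Measure ℝ) := ψ.2

/-- The operator of multiplication by a matrix-valued function `V`, on its maximal domain, which
is all of `L²(ℝ, ℂ²)` when `V` is bounded and measurable. -/
def potential (V : ℝ → Matrix (Fin 2) (Fin 2) ℂ) : L2Spinor →ₗ.[ℂ] L2Spinor where
  domain := mulDomain V
  toFun :=
    { toFun := fun ψ => (memLp_of_mem_mulDomain ψ).toLp (mulFun V ψ)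
      map_add' := fun ψ χ =>
        (MemLp.toLp_congr _ ((memLp_of_mem_mulDomain ψ).add (memLp_of_mem_mulDomain χ))
          (mulFun_add V ψ χ)).trans (MemLp.toLp_add _ _)
      map_smul' := fun c ψ =>
        (MemLp.toLp_congr _ ((memLp_of_mem_mulDomain ψ).const_smul c)
          (mulFun_smul V c ψ)).trans (MemLp.toLp_const_smul _ _) }

/-- The Dirac operator `J₀ ∂ₓ + V(x)` in `L²(ℝ, ℂ²)`; its domain is the intersection of the domains
of the two summands, which is `H¹(ℝ, ℂ²)` when `V` is bounded. -/
def operator (V : ℝ → Matrix (Fin 2) (Fin 2) ℂ) : L2Spinor →ₗ.[ℂ] L2Spinor :=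
  kinetic + potential V

/-- The symbol of `J₀ ∂ₓ + V(x)`, in which `∂ₓ` is replaced by `i ξ`. -/
def symbol (V : ℝ → Matrix (Fin 2) (Fin 2) ℂ) (x ξ : ℝ) : Matrix (Fin 2) (Fin 2) ℂ :=
  (Complex.I * (ξ : ℂ)) • J₀ + V x

/-- `φ = (v, u)`, real-valued, is the profile of a solitary wave `φ(x) exp(-iωt)` of the
nonlinear Dirac equation `i ∂ₜψ₁ = ∂ₓψ₂ + g(|ψ₁|² - |ψ₂|²) ψ₁`,
`i ∂ₜψ₂ = -∂ₓψ₁ - g(|ψ₁|² - |ψ₂|²) ψ₂`: it lies in `H¹(ℝ, ℂ²)` and satisfies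
`ω v = u' + g(v² - u²) v`, `ω u = -v' - g(v² - u²) u`. -/
structure IsSolitaryWave (g : ℝ → ℝ) (ω : ℝ) (v u : ℝ → ℝ) : Prop where
  memH1 : ∃ h : MemLp (fun x => (!₂[(v x : ℂ), (u x : ℂ)] : Spinor)) 2 (volume : Measure ℝ),
    h.toLp ∈ sobolevH1
  differentiable_v : Differentiable ℝ v
  differentiable_u : Differentiable ℝ u
  eq_v : ∀ x, ω * v x = deriv u x + g (v x ^ 2 - u x ^ 2) * v x
  eq_u : ∀ x, ω * u x = -deriv v x - g (v x ^ 2 - u x ^ 2) * u x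

/-- The zeroth-order part of `𝓗₋`, with `g = g(v² - u²)`. -/
def Vminus (g : ℝ → ℝ) (ω : ℝ) (v u : ℝ → ℝ) (x : ℝ) : Matrix (Fin 2) (Fin 2) ℂ :=
  let G := g (v x ^ 2 - u x ^ 2)
  (!![G - ω, 0; 0, -G - ω] : Matrix (Fin 2) (Fin 2) ℝ).map (fun r : ℝ => (r : ℂ))

/-- The zeroth-order part of `𝓗₊`, with `g = g(v² - u²)` and `g' = g'(v² - u²)`. -/
def Vplus (g : ℝ → ℝ) (ω : ℝ) (v u : ℝ → ℝ) (x : ℝ) : Matrix (Fin 2) (Fin 2) ℂ :=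
  let G := g (v x ^ 2 - u x ^ 2)
  let G' := deriv g (v x ^ 2 - u x ^ 2)
  (!![2 * G' * v x ^ 2 + G - ω, -2 * G' * v x * u x;
      -2 * G' * v x * u x, 2 * G' * u x ^ 2 - G - ω] : Matrix (Fin 2) (Fin 2) ℝ).map
    (fun r : ℝ => (r : ℂ))

/-- The operator `𝓗₋ = [g - ω, ∂ₓ; -∂ₓ, -g - ω]`. -/
def Hminus (g : ℝ → ℝ) (ω : ℝ) (v u : ℝ → ℝ) : L2Spinor →ₗ.[ℂ] L2Spinor :=
  operator (Vminus g ω v u)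

/-- The operator `𝓗₊ = [2g'v² + g - ω, ∂ₓ - 2g'vu; -∂ₓ - 2g'vu, 2g'u² - g - ω]`. -/
def Hplus (g : ℝ → ℝ) (ω : ℝ) (v u : ℝ → ℝ) : L2Spinor →ₗ.[ℂ] L2Spinor :=
  operator (Vplus g ω v u)

end Dirac

end

/-!
The potentials of `𝓗₊` and `𝓗₋` converge at infinity to the constant matrix `Vlim ω = diag(1 - ω,
-1 - ω)`: the wave `φ` lies in `H¹`, so its Fourier transform is integrable and `φ` vanishes at
infinity by the Riemann–Lebesgue lemma (`Dirac.tendsto_zero_of_mem_sobolevH1`). Hence both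
operators are perturbations of the free operator `H₀ = J₀ ∂ₓ + Vlim ω` by a bounded potential `W`
that vanishes at infinity, and the claim about spectra is Weyl's theorem on the invariance of the
essential spectrum, together with the computation of the spectrum of `H₀`.

The Fourier transform turns `H₀ + ω` into multiplication by `A(ξ) = 2πiξ J₀ + σ₃`, and `A(ξ)² = 1
+ (2πξ)²`. So `(A(ξ) - s)⁻¹ = (A(ξ) + s) / (1 + (2πξ)² - s²)`, with `s = z + ω`, gives the
resolvent of `H₀` explicitly unless `s` is real with `|s| ≥ 1`; in this exceptional case wave
packets concentrated at a zero of the denominator show that `z` lies in the spectrum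
(`Dirac.spectrum_freeOperator`). Since the denominator has at most two zeros, `H₀` has no
eigenvalues.

`W` is compact relative to `H₀` (`Dirac.isRelCompact_freeOperator`): the symbol of the free
resolvent and `W` both vanish at infinity, so `W (H₀ - z)⁻¹` is a norm limit of operators that
contain the localization to bounded sets of positions and of frequencies. This localization has
the integral kernel `exp (2πixξ)` on a bounded square, where the exponential series converges
uniformly, so it is a norm limit of operators of finite rank (`Dirac.isCompactOperator_cutoff`).

Weyl's theorem (`UnboundedOperator.essentialSpectrum_eq_spectrum`) follows from the Fredholm
alternative for `T - z = (1 + W (T₀ - z)⁻¹) (T₀ - z)`. If `z` is in the resolvent set of `T₀`,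
then it is in that of `T` unless it is an eigenvalue, which then has finite multiplicity and is
isolated, because normalized eigenvectors for distinct eigenvalues accumulating at `z` would have
a limit that is an eigenvector orthogonal to itself. Exchanging `T` and `T₀`, and using that `T₀`
has no eigenvalues, the spectrum of `T₀` is contained in that of `T`; it has no isolated points,
so it is disjoint from the discrete spectrum of `T`.
-/

/-! ### Relatively compact perturbations of unbounded operators -/

namespace UnboundedOperator

variable {H : Type*} [NormedAddCommGroup H] [InnerProductSpace ℂ H]

/-- `T = T₀ + W` with `W` bounded and everywhere defined. -/
structure IsBoundedPerturbation (T₀ T : H →ₗ.[ℂ] H) (W : H →L[ℂ] H) : Prop where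
  domain_eq : T.domain = T₀.domain
  apply_eq : ∀ (x : H) (h : x ∈ T.domain) (h₀ : x ∈ T₀.domain), T ⟨x, h⟩ = T₀ ⟨x, h₀⟩ + W x

/-- `W` is compact relative to `T`, that is, compact from the domain of `T` with its graph norm to
`H`. This is encoded without that norm: `W R` is compact for every bounded `R` that has its range in
the domain of `T` and for which `B = T R` is bounded. -/
def IsRelCompact (T : H →ₗ.[ℂ] H) (W : H →L[ℂ] H) : Prop :=
  ∀ R B : H →L[ℂ] H, (∀ y, ∃ h : R y ∈ T.domain, T ⟨R y, h⟩ = B y) → IsCompactOperator (W ∘L R)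

/-- `T` is symmetric (its domain is not required to be dense). -/
def IsSymm (T : H →ₗ.[ℂ] H) : Prop :=
  ∀ x y : T.domain, inner ℂ (T x) (y : H) = inner ℂ (x : H) (T y)

theorem mem_eigenspace {T : H →ₗ.[ℂ] H} {z : ℂ} {x : T.domain} :
    x ∈ eigenspace T z ↔ T x = z • (x : H) := by
  change T x - z • (x : H) = 0 ↔ _
  exact sub_eq_zero

namespace IsBoundedPerturbation

variable {T₀ T : H →ₗ.[ℂ] H} {W : H →L[ℂ] H}

theorem symm (h : IsBoundedPerturbation T₀ T W) : IsBoundedPerturbation T T₀ (-W) where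
  domain_eq := h.domain_eq.symm
  apply_eq x h₁ h₂ := by
    rw [h.apply_eq x h₂ h₁, neg_apply, add_neg_cancel_right]

theorem isRelCompact_neg (h : IsBoundedPerturbation T₀ T W) (hW : IsRelCompact T₀ W) :
    IsRelCompact T (-W) := by
  intro R B hRB
  have : IsCompactOperator (W ∘L R) := by
    refine hW R (B - W ∘L R) fun y => ?_
    obtain ⟨h₁, h₂⟩ := hRB y
    have h₃ : R y ∈ T₀.domain := h.domain_eq ▸ h₁
    refine ⟨h₃, ?_⟩
    rw [h.apply_eq _ h₁ h₃] at h₂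
    rw [sub_apply, ContinuousLinearMap.comp_apply, ← h₂, add_sub_cancel_right]
  simpa using! this.neg

end IsBoundedPerturbation

/-- A relatively compact perturbation is compact after composition with a resolvent. -/
theorem IsRelCompact.comp_resolvent {T : H →ₗ.[ℂ] H} {W R : H →L[ℂ] H} (hW : IsRelCompact T W)
    {z : ℂ} (hR : ∀ y : H, ∃ h : R y ∈ T.domain, T ⟨R y, h⟩ - z • R y = y) :
    IsCompactOperator (W ∘L R) := by
  refine hW R (1 + z • R) fun y => ?_
  obtain ⟨h, hy⟩ := hR y
  exact ⟨h, sub_eq_iff_eq_add.mp hy⟩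

/-- The kernel of `1 + K` is finite-dimensional when `K` is compact, since `-K` is the identity
there. -/
theorem finiteDimensional_ker_one_add {K : H →L[ℂ] H} (hK : IsCompactOperator K) :
    FiniteDimensional ℂ (LinearMap.ker ((1 + K : H →L[ℂ] H) : H →ₗ[ℂ] H)) := by
  have hmem : ∀ f ∈ LinearMap.ker ((1 + K : H →L[ℂ] H) : H →ₗ[ℂ] H),
      ((-K : H →L[ℂ] H) : H →ₗ[ℂ] H) f = f := fun f hf => by
    have hf' : f + K f = 0 := hf
    exact (eq_neg_of_add_eq_zero_left hf').symm
  apply FiniteDimensional.of_isCompactOperator_id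
  have hK' : IsCompactOperator ((-K : H →L[ℂ] H) : H →ₗ[ℂ] H) := by
    simpa using! hK.neg
  have h₁ := hK'.restrict (fun f hf => (hmem f hf).symm ▸ hf) (1 + K).isClosed_ker
  have h₂ : ⇑(((-K : H →L[ℂ] H) : H →ₗ[ℂ] H).restrict
      (fun f hf => (hmem f hf).symm ▸ hf)) = id := funext fun f => Subtype.ext (hmem f f.2)
  rwa [h₂] at h₁

/-- Off the spectrum of `T₀`, the map `T₀ - z`, which is `-W` on the eigenspace of `T`, embeds this
eigenspace into the kernel of `1 + W R`, where `R` is the resolvent of `T₀`. -/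
theorem finiteDimensional_eigenspace {T₀ T : H →ₗ.[ℂ] H} {W : H →L[ℂ] H}
    (h : IsBoundedPerturbation T₀ T W) (hW : IsRelCompact T₀ W) {z : ℂ}
    (hz : z ∈ resolventSet T₀) : FiniteDimensional ℂ (eigenspace T z) := by
  obtain ⟨R, hR₁, hR₂⟩ := hz
  have hN := finiteDimensional_ker_one_add (hW.comp_resolvent hR₁)
  have key : ∀ x : eigenspace T z, R (-W ((x : T.domain) : H)) = ((x : T.domain) : H) := by
    intro x
    have hd : ((x : T.domain) : H) ∈ T₀.domain := h.domain_eq ▸ (x : T.domain).2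
    have e₁ := mem_eigenspace.mp x.2
    have e₂ := h.apply_eq (x : T.domain) (x : T.domain).2 hd
    simp only [Subtype.coe_eta] at e₂
    have e₃ : T₀ ⟨_, hd⟩ - z • ((x : T.domain) : H) = -W ((x : T.domain) : H) := by
      rw [← e₁, e₂]
      abel
    rw [← e₃]
    exact hR₂ ⟨_, hd⟩
  let ι : eigenspace T z →ₗ[ℂ] LinearMap.ker ((1 + W ∘L R : H →L[ℂ] H) : H →ₗ[ℂ] H) :=
    ((-W : H →L[ℂ] H) : H →ₗ[ℂ] H).comp (T.domain.subtype.comp (eigenspace T z).subtype)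
      |>.codRestrict _ fun x => by
        change -W ((x : T.domain) : H) + W (R (-W ((x : T.domain) : H))) = 0
        rw [key, neg_add_cancel]
  refine FiniteDimensional.of_injective ι fun x y hxy => ?_
  have e : -W ((x : T.domain) : H) = -W ((y : T.domain) : H) := congrArg Subtype.val hxy
  exact Subtype.ext (Subtype.ext (by rw [← key x, ← key y, e]))

theorem IsSymm.conj_eq {T : H →ₗ.[ℂ] H} (hT : IsSymm T) {z : ℂ} {x : T.domain}
    (hx : T x = z • (x : H)) (hx0 : (x : H) ≠ 0) : (starRingEnd ℂ) z = z := by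
  have := hT x x
  rw [hx, inner_smul_left, inner_smul_right] at this
  exact mul_right_cancel₀ (inner_self_ne_zero.mpr hx0) this

theorem IsSymm.inner_eq_zero {T : H →ₗ.[ℂ] H} (hT : IsSymm T) {z w : ℂ} {x y : T.domain}
    (hx : T x = z • (x : H)) (hy : T y = w • (y : H)) (hzw : z ≠ w) :
    inner ℂ (x : H) (y : H) = 0 := by
  by_cases hx0 : (x : H) = 0
  · rw [hx0, inner_zero_left]
  have := hT x y
  rw [hx, hy, inner_smul_left, inner_smul_right, hT.conj_eq hx hx0] at this
  by_contra h0
  exact hzw (mul_right_cancel₀ h0 this)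

/-- Eigenvalues of a symmetric relatively compact perturbation do not accumulate at a point of the
resolvent set of `T₀`: normalized eigenvectors would have a limit, which would be an eigenvector
orthogonal to itself. -/
theorem exists_ball_forall_eigenspace_eq_bot {T₀ T : H →ₗ.[ℂ] H} {W : H →L[ℂ] H}
    (h : IsBoundedPerturbation T₀ T W) (hW : IsRelCompact T₀ W) (hT : IsSymm T) {z : ℂ}
    (hz : z ∈ resolventSet T₀) :
    ∃ ε > 0, ∀ w ∈ Metric.ball z ε, w ≠ z → eigenspace T w = ⊥ := by
  by_contra! hcon
  obtain ⟨R, hR₁, hR₂⟩ := hz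
  have hK : IsCompactOperator (W ∘L R) := hW.comp_resolvent hR₁
  have hcon' : ∀ n : ℕ, ∃ w : ℂ, ∃ x : T.domain, ‖w - z‖ < 1 / ((n : ℝ) + 1) ∧ w ≠ z ∧
      T x = w • (x : H) ∧ ‖(x : H)‖ = 1 := by
    intro n
    obtain ⟨w, hw, hwz, hbot⟩ := hcon (1 / ((n : ℝ) + 1)) (by positivity)
    obtain ⟨x, hx, hx0⟩ := Submodule.exists_mem_ne_zero_of_ne_bot hbot
    rw [mem_eigenspace] at hx
    have hx0' : ‖(x : H)‖ ≠ 0 := by simpa using hx0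
    refine ⟨w, ((‖(x : H)‖⁻¹ : ℝ) : ℂ) • x, by simpa [dist_eq_norm] using hw, hwz, ?_, ?_⟩
    · rw [LinearPMap.map_smul, hx, smul_comm]
      rfl
    · rw [Submodule.coe_smul, norm_smul]
      simp [hx0']
  choose w x hw hwz hx hx1 using hcon'
  have hd : ∀ n, (x n : H) ∈ T₀.domain := fun n => h.domain_eq ▸ (x n).2
  set f : ℕ → H := fun n => T₀ ⟨x n, hd n⟩ - z • (x n : H) with hf
  have hRf : ∀ n, R (f n) = x n := fun n => hR₂ ⟨x n, hd n⟩
  have hfW : ∀ n, f n = (w n - z) • (x n : H) - W (R (f n)) := fun n => by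
    have e := h.apply_eq (x n) (x n).2 (hd n)
    simp only [Subtype.coe_eta] at e
    rw [hx, ← sub_eq_iff_eq_add] at e
    rw [hRf, hf]
    simp only
    rw [← e, sub_smul]
    abel
  have hlim0 : Filter.Tendsto (fun n => (w n - z) • (x n : H)) Filter.atTop (𝓝 0) := by
    refine squeeze_zero_norm (fun n => ?_) tendsto_one_div_add_atTop_nhds_zero_nat
    rw [norm_smul, hx1, mul_one]
    exact (hw n).le
  have hbd : ∀ n, ‖f n‖ ≤ 1 + ‖W‖ := fun n => by
    rw [hfW n, hRf]
    refine (norm_sub_le _ _).trans (add_le_add ?_ ?_)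
    · rw [norm_smul, hx1, mul_one]
      refine (hw n).le.trans ?_
      rw [div_le_one (by positivity)]
      linarith [(Nat.cast_nonneg n : (0 : ℝ) ≤ n)]
    · simpa [hx1] using W.le_opNorm (x n : H)
  obtain ⟨K, hKc, hKs⟩ := hK.image_closedBall_subset_compact (1 + ‖W‖)
  obtain ⟨y, -, φ, hφ, hy⟩ := hKc.tendsto_subseq (x := fun n => W (R (f n)))
    (fun n => hKs ⟨f n, by simpa using hbd n, rfl⟩)
  have hflim : Filter.Tendsto (f ∘ φ) Filter.atTop (𝓝 (-y)) := by
    have := (hlim0.comp hφ.tendsto_atTop).sub hy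
    rw [zero_sub] at this
    refine this.congr fun n => ?_
    exact (hfW (φ n)).symm
  have hxlim : Filter.Tendsto (fun n => (x (φ n) : H)) Filter.atTop (𝓝 (R (-y))) := by
    refine ((R.continuous.tendsto _).comp hflim).congr fun n => ?_
    exact hRf (φ n)
  have hnorm : ‖R (-y)‖ = 1 := by
    refine tendsto_nhds_unique hxlim.norm ?_
    simp [hx1]
  have hWy : W (R (-y)) = y := by
    refine tendsto_nhds_unique ((W.continuous.tendsto _).comp hxlim) (hy.congr fun n => ?_)
    simp [hRf]
  obtain ⟨h₀, h₁⟩ := hR₁ (-y)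
  have hd' : R (-y) ∈ T.domain := h.domain_eq ▸ h₀
  have hev : T ⟨R (-y), hd'⟩ = z • R (-y) := by
    rw [h.apply_eq _ hd' h₀, sub_eq_iff_eq_add.mp h₁, hWy]
    abel
  have hin : Filter.Tendsto (fun n => inner ℂ (x (φ n) : H) (R (-y))) Filter.atTop
      (𝓝 (inner ℂ (R (-y)) (R (-y)))) := hxlim.inner tendsto_const_nhds
  have hzero : ∀ n, inner ℂ (x (φ n) : H) (R (-y)) = 0 := fun n =>
    hT.inner_eq_zero (y := ⟨R (-y), hd'⟩) (hx _) hev (hwz _)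
  simp only [hzero] at hin
  have := tendsto_nhds_unique hin tendsto_const_nhds
  rw [inner_self_eq_zero] at this
  rw [this, norm_zero] at hnorm
  exact zero_ne_one hnorm

variable [CompleteSpace H]

/-- Fredholm alternative for `T - z = (1 + W R) (T₀ - z)`, where `R` is the resolvent of `T₀`. -/
theorem mem_resolventSet_of_eigenspace_eq_bot {T₀ T : H →ₗ.[ℂ] H} {W : H →L[ℂ] H}
    (h : IsBoundedPerturbation T₀ T W) (hW : IsRelCompact T₀ W) {z : ℂ}
    (hz : z ∈ resolventSet T₀) (hker : eigenspace T z = ⊥) : z ∈ resolventSet T := by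
  obtain ⟨R, hR₁, hR₂⟩ := hz
  have hK : IsCompactOperator (W ∘L R) := hW.comp_resolvent hR₁
  have hev : ¬ Module.End.HasEigenvalue ((W ∘L R : H →L[ℂ] H) : Module.End ℂ H) (-1) := by
    intro hev
    obtain ⟨f, hf, hf0⟩ := hev.exists_hasEigenvector
    rw [Module.End.mem_eigenspace_iff] at hf
    replace hf : W (R f) = -f := by simpa using hf
    obtain ⟨h₀, h₁⟩ := hR₁ f
    have hd : R f ∈ T.domain := h.domain_eq ▸ h₀
    have hmem : (⟨R f, hd⟩ : T.domain) ∈ eigenspace T z := by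
      rw [mem_eigenspace, h.apply_eq _ hd h₀, hf, sub_eq_iff_eq_add.mp h₁]
      simp
    rw [hker, Submodule.mem_bot] at hmem
    have hRf : R f = 0 := congrArg Subtype.val hmem
    rw [hRf, map_zero] at hf
    exact hf0 (neg_eq_zero.mp hf.symm)
  have hunit : IsUnit (1 + W ∘L R) := by
    have := (hK.hasEigenvalue_or_mem_resolventSet (μ := (-1 : ℂ)) (by simp)).resolve_left hev
    rw [spectrum.mem_resolventSet_iff, ← IsUnit.neg_iff] at this
    convert this using 1
    simp [add_comm]
  obtain ⟨S, hS₁, hS₂⟩ := isUnit_iff_exists.mp hunit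
  refine ⟨R ∘L S, fun y => ?_, fun x => ?_⟩
  · obtain ⟨h₀, h₁⟩ := hR₁ (S y)
    have hd : R (S y) ∈ T.domain := h.domain_eq ▸ h₀
    refine ⟨hd, ?_⟩
    have e := congrArg (fun A : H →L[ℂ] H => A y) hS₁
    have e' : S y + W (R (S y)) = y := by simpa using e
    change T ⟨R (S y), hd⟩ - z • R (S y) = y
    rw [h.apply_eq _ hd h₀, add_sub_right_comm, h₁, e']
  · have hd : (x : H) ∈ T₀.domain := h.domain_eq ▸ x.2
    have e₀ := hR₂ ⟨x, hd⟩
    set f := T₀ ⟨x, hd⟩ - z • (x : H) with hf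
    have e₁ : T x - z • (x : H) = (1 + W ∘L R) f := by
      have := h.apply_eq x x.2 hd
      simp only [Subtype.coe_eta] at this
      rw [this]
      simp only [add_apply, ContinuousLinearMap.comp_apply,
        one_apply_eq_self]
      rw [e₀, hf]
      abel
    rw [e₁]
    change R ((S * (1 + W ∘L R)) f) = x
    rw [hS₂]
    exact e₀

/-- **Weyl's theorem** in the form needed for a `T₀` without eigenvalues whose spectrum has no
isolated points. -/
theorem essentialSpectrum_eq_spectrum {T₀ T : H →ₗ.[ℂ] H} {W : H →L[ℂ] H}
    (h : IsBoundedPerturbation T₀ T W) (hW : IsRelCompact T₀ W) (hT : IsSymm T)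
    (h₀ : ∀ z, eigenspace T₀ z = ⊥) (hc : IsClosed (spectrum T₀)) (hp : Preperfect (spectrum T₀)) :
    essentialSpectrum T = spectrum T₀ := by
  have hsub : spectrum T₀ ⊆ spectrum T := fun z hz hz' =>
    hz (mem_resolventSet_of_eigenspace_eq_bot h.symm (h.isRelCompact_neg hW) hz' (h₀ z))
  apply Set.Subset.antisymm
  · rintro z ⟨hz, hzd⟩
    by_contra hz₀
    have hz₀' : z ∈ resolventSet T₀ := Set.notMem_compl_iff.mp hz₀
    obtain ⟨ε, hε, hball⟩ := exists_ball_forall_eigenspace_eq_bot h hW hT hz₀'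
    obtain ⟨δ, hδ, hδball⟩ := Metric.isOpen_iff.mp hc.isOpen_compl z hz₀
    refine hzd ⟨⟨min ε δ, lt_min hε hδ, ?_⟩, fun hbot =>
      hz (mem_resolventSet_of_eigenspace_eq_bot h hW hz₀' hbot),
      finiteDimensional_eigenspace h hW hz₀'⟩
    refine Set.Subset.antisymm ?_ ?_
    · rintro w ⟨hw, hws⟩
      by_contra hwz
      refine hws (mem_resolventSet_of_eigenspace_eq_bot h hW ?_
        (hball w (Metric.ball_subset_ball (min_le_left _ _) hw) hwz))
      exact Set.notMem_compl_iff.mp (hδball (Metric.ball_subset_ball (min_le_right _ _) hw))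
    · rintro w rfl
      exact ⟨Metric.mem_ball_self (lt_min hε hδ), hz⟩
  · intro z hz
    refine ⟨hsub hz, ?_⟩
    rintro ⟨⟨ε, hε, hball⟩, -⟩
    obtain ⟨y, ⟨hyb, hys⟩, hyz⟩ := (accPt_iff_nhds.mp (hp z hz)) _ (Metric.ball_mem_nhds z hε)
    have : y ∈ ({z} : Set ℂ) := hball ▸ ⟨hyb, hsub hys⟩
    exact hyz this

end UnboundedOperator

namespace Dirac

open UnboundedOperator
open scoped FourierTransform

noncomputable section

/-! ### Multiplication operators on `L²(ℝ, ℂ²)` -/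

/-- A bounded measurable field of linear maps of `ℂ²`. -/
structure IsBddMul (A : ℝ → Spinor →L[ℂ] Spinor) : Prop where
  aestronglyMeasurable : AEStronglyMeasurable A volume
  exists_bound : ∃ C, 0 ≤ C ∧ ∀ x, ‖A x‖ ≤ C

theorem IsBddMul.memLp {A : ℝ → Spinor →L[ℂ] Spinor} (hA : IsBddMul A) (f : L2Spinor) :
    MemLp (fun x => A x (f x)) 2 volume := by
  obtain ⟨C, -, hC⟩ := hA.exists_bound
  refine (Lp.memLp f).of_le_mul (c := C) ?_ (.of_forall fun x => ?_)
  · exact isBoundedBilinearMap_apply.continuous.comp_aestronglyMeasurable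
      (hA.aestronglyMeasurable.prodMk (Lp.aestronglyMeasurable f))
  · exact ((A x).le_opNorm _).trans (by gcongr; exact hC x)

/-- The bounded operator on `L²(ℝ, ℂ²)` of pointwise application of a bounded measurable field of
linear maps. -/
def mulCLM (A : ℝ → Spinor →L[ℂ] Spinor) (hA : IsBddMul A) : L2Spinor →L[ℂ] L2Spinor :=
  LinearMap.mkContinuousOfExistsBound
    { toFun := fun f => (hA.memLp f).toLp
      map_add' := fun f g => by
        rw [← MemLp.toLp_add]
        refine MemLp.toLp_congr _ _ ?_
        filter_upwards [Lp.coeFn_add f g] with x hx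
        change A x ((f + g : L2Spinor) x) = A x (f x) + A x (g x)
        rw [hx, Pi.add_apply, map_add]
      map_smul' := fun c f => by
        rw [RingHom.id_apply, ← MemLp.toLp_const_smul]
        refine MemLp.toLp_congr _ _ ?_
        filter_upwards [Lp.coeFn_smul c f] with x hx
        change A x ((c • f : L2Spinor) x) = c • A x (f x)
        rw [hx, Pi.smul_apply, map_smul] }
    (by
      obtain ⟨C, -, hC⟩ := hA.exists_bound
      refine ⟨C, fun f => Lp.norm_le_mul_norm_of_ae_le_mul ?_⟩
      filter_upwards [(hA.memLp f).coeFn_toLp] with x hx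
      simp only [LinearMap.coe_mk, AddHom.coe_mk]
      rw [hx]
      exact ((A x).le_opNorm _).trans (by gcongr; exact hC x))

theorem coeFn_mulCLM {A : ℝ → Spinor →L[ℂ] Spinor} (hA : IsBddMul A) (f : L2Spinor) :
    mulCLM A hA f =ᵐ[volume] fun x => A x (f x) :=
  (hA.memLp f).coeFn_toLp

theorem norm_mulCLM_le {A : ℝ → Spinor →L[ℂ] Spinor} (hA : IsBddMul A) {C : ℝ} (hC0 : 0 ≤ C)
    (hC : ∀ x, ‖A x‖ ≤ C) : ‖mulCLM A hA‖ ≤ C := by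
  refine ContinuousLinearMap.opNorm_le_bound _ hC0 fun f => ?_
  refine Lp.norm_le_mul_norm_of_ae_le_mul ?_
  filter_upwards [coeFn_mulCLM hA f] with x hx
  rw [hx]
  exact ((A x).le_opNorm _).trans (by gcongr; exact hC x)

theorem IsBddMul.sub {A B : ℝ → Spinor →L[ℂ] Spinor} (hA : IsBddMul A) (hB : IsBddMul B) :
    IsBddMul (fun x => A x - B x) := by
  obtain ⟨C, hC0, hC⟩ := hA.exists_bound
  obtain ⟨D, hD0, hD⟩ := hB.exists_bound
  exact ⟨hA.1.sub hB.1, C + D, by positivity,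
    fun x => (norm_sub_le _ _).trans (add_le_add (hC x) (hD x))⟩

theorem mulCLM_sub {A B : ℝ → Spinor →L[ℂ] Spinor} (hA : IsBddMul A) (hB : IsBddMul B) :
    mulCLM (fun x => A x - B x) (hA.sub hB) = mulCLM A hA - mulCLM B hB := by
  ext1 f
  refine Lp.ext ?_
  rw [sub_apply]
  filter_upwards [coeFn_mulCLM (hA.sub hB) f, coeFn_mulCLM hA f, coeFn_mulCLM hB f,
    Lp.coeFn_sub (mulCLM A hA f) (mulCLM B hB f)] with x h1 h2 h3 h4
  rw [h1, h4, Pi.sub_apply, h2, h3, sub_apply]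

theorem IsBddMul.comp {A B : ℝ → Spinor →L[ℂ] Spinor} (hA : IsBddMul A) (hB : IsBddMul B) :
    IsBddMul (fun x => A x ∘L B x) := by
  obtain ⟨C, hC0, hC⟩ := hA.exists_bound
  obtain ⟨D, hD0, hD⟩ := hB.exists_bound
  refine ⟨isBoundedBilinearMap_comp.continuous.comp_aestronglyMeasurable (hA.1.prodMk hB.1),
    C * D, by positivity, fun x => (ContinuousLinearMap.opNorm_comp_le _ _).trans ?_⟩
  gcongr
  exacts [hC x, hD x]

theorem mulCLM_comp {A B : ℝ → Spinor →L[ℂ] Spinor} (hA : IsBddMul A) (hB : IsBddMul B) :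
    mulCLM (fun x => A x ∘L B x) (hA.comp hB) = mulCLM A hA ∘L mulCLM B hB := by
  ext1 f
  refine Lp.ext ?_
  filter_upwards [coeFn_mulCLM (hA.comp hB) f, coeFn_mulCLM hA (mulCLM B hB f),
    coeFn_mulCLM hB f] with x h1 h2 h3
  rw [h1, ContinuousLinearMap.comp_apply, ← h3, ← h2, ContinuousLinearMap.comp_apply]

theorem memLp_indicator_of_continuous {E : Type*} [NormedAddCommGroup E] {S : Set ℝ}
    (hS : MeasurableSet S) (hb : Bornology.IsBounded S) {φ : ℝ → E} (hφ : Continuous φ) :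
    MemLp (S.indicator φ) 2 volume := by
  refine (memLp_indicator_iff_restrict hS).mpr ?_
  have : IsFiniteMeasure (volume.restrict S) := ⟨by simpa using hb.measure_lt_top⟩
  obtain ⟨r, hr⟩ := hb.subset_closedBall 0
  obtain ⟨C, hC⟩ := (isCompact_closedBall (0 : ℝ) r).exists_bound_of_continuousOn hφ.continuousOn
  exact MemLp.of_bound hφ.aestronglyMeasurable C
    ((ae_restrict_iff' hS).mpr (.of_forall fun ξ hξ => hC ξ (hr hξ)))

/-! ### The Fourier transform on `L²` and the space `H¹` -/

/-- Schwartz functions separate locally integrable functions. -/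
theorem ae_eq_of_forall_schwartz {f f' : ℝ → Spinor} (hf : LocallyIntegrable f)
    (hf' : LocallyIntegrable f') (h : ∀ g : 𝓢(ℝ, ℂ), ∫ x, g x • f x = ∫ x, g x • f' x) :
    f =ᵐ[volume] f' := by
  refine ae_eq_of_integral_contDiff_smul_eq hf hf' fun g hg hgc => ?_
  have h₁ : HasCompactSupport (Complex.ofRealCLM ∘ g) := hgc.comp_left rfl
  have h₂ : ContDiff ℝ (⊤ : ℕ∞) (Complex.ofRealCLM ∘ g) :=
    Complex.ofRealCLM.contDiff.comp hg
  simpa using h (h₁.toSchwartzMap h₂)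

/-- A distributional identity `m f = h` between `L²` functions holds almost everywhere. -/
theorem smulLeftCLM_eq_iff {m : ℝ → ℂ} (hm : m.HasTemperateGrowth) (f h : L2Spinor) :
    smulLeftCLM Spinor m (f : 𝓢'(ℝ, Spinor)) = (h : 𝓢'(ℝ, Spinor)) ↔
      h =ᵐ[volume] fun x => m x • f x := by
  have key : ∀ g : 𝓢(ℝ, ℂ), smulLeftCLM Spinor m (f : 𝓢'(ℝ, Spinor)) g =
      ∫ x, g x • (m x • f x) := fun g => by
    simp [hm, smul_smul, mul_comm]
  constructor
  · intro heq
    refine ae_eq_of_forall_schwartz ((Lp.memLp h).locallyIntegrable one_le_two)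
      (((Lp.memLp f).locallyIntegrable one_le_two).continuous_smul hm.1.continuous) fun g => ?_
    rw [← key, heq, Lp.toTemperedDistribution_apply]
  · intro heq
    ext1 g
    rw [key, Lp.toTemperedDistribution_apply]
    refine integral_congr_ae ?_
    filter_upwards [heq] with x hx
    rw [hx]

/-- On the Fourier side `∂ₓ` is multiplication by `2πiξ`. -/
theorem lineDeriv_eq_iff (ψ η : L2Spinor) :
    ∂_{(1 : ℝ)} (ψ : 𝓢'(ℝ, Spinor)) = (η : 𝓢'(ℝ, Spinor)) ↔
      (𝓕 η : L2Spinor) =ᵐ[volume]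
        fun ξ => (2 * Real.pi * Complex.I * (ξ : ℂ)) • (𝓕 ψ : L2Spinor) ξ := by
  have hm : (fun ξ : ℝ => 2 * (Real.pi : ℂ) * Complex.I * (ξ : ℂ)).HasTemperateGrowth := by
    have : (fun ξ : ℝ => (ξ : ℂ)).HasTemperateGrowth := by fun_prop
    fun_prop
  rw [← smulLeftCLM_eq_iff hm, ← Lp.fourier_toTemperedDistribution_eq,
    ← Lp.fourier_toTemperedDistribution_eq]
  have e : 𝓕 (∂_{(1 : ℝ)} (ψ : 𝓢'(ℝ, Spinor))) =
      smulLeftCLM Spinor (fun ξ : ℝ => 2 * (Real.pi : ℂ) * Complex.I * (ξ : ℂ))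
        (𝓕 (ψ : 𝓢'(ℝ, Spinor))) := by
    rw [fourier_lineDerivOp_eq, ← smul_apply, ← smulLeftCLM_smul (by fun_prop)]
    congr 2
    ext ξ
    simp
  rw [← e]
  exact ⟨fun h => by rw [h], fun h => (FourierTransform.fourierEquiv ℂ 𝓢'(ℝ, Spinor)).injective h⟩

theorem fourier_derivH1 (ψ : sobolevH1) :
    (𝓕 (derivH1 ψ) : L2Spinor) =ᵐ[volume]
      fun ξ => (2 * Real.pi * Complex.I * (ξ : ℂ)) • (𝓕 (ψ : L2Spinor) : L2Spinor) ξ :=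
  (lineDeriv_eq_iff _ _).mp (derivH1_spec ψ)

/-- Square integrability of `ξ ↦ 2πiξ ψ̂(ξ)` characterizes `H¹`. -/
theorem exists_derivH1_eq {ψ η : L2Spinor} (h : (𝓕 η : L2Spinor) =ᵐ[volume]
    fun ξ => (2 * Real.pi * Complex.I * (ξ : ℂ)) • (𝓕 ψ : L2Spinor) ξ) :
    ∃ hψ : ψ ∈ sobolevH1, derivH1 ⟨ψ, hψ⟩ = η := by
  have hψ : ψ ∈ sobolevH1 := by
    change MemSobolev 1 2 (ψ : 𝓢'(ℝ, Spinor))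
    refine (memSobolev_iff_exists_smulLeftCLM_fourier (E := ℝ) (F := Spinor)).mpr ?_
    have hmeas : AEStronglyMeasurable
        (fun ξ : ℝ => (((1 + ‖ξ‖ ^ 2) ^ ((1 : ℝ) / 2) : ℝ) : ℂ) • (𝓕 ψ : L2Spinor) ξ) volume := by
      have : (fun ξ : ℝ => (((1 + ‖ξ‖ ^ 2) ^ ((1 : ℝ) / 2) : ℝ) : ℂ)).HasTemperateGrowth := by
        fun_prop
      exact this.1.continuous.aestronglyMeasurable.smul (Lp.aestronglyMeasurable (𝓕 ψ : L2Spinor))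
    have hmem : MemLp
        (fun ξ : ℝ => (((1 + ‖ξ‖ ^ 2) ^ ((1 : ℝ) / 2) : ℝ) : ℂ) • (𝓕 ψ : L2Spinor) ξ) 2 volume := by
      refine MemLp.of_le ((Lp.memLp (𝓕 ψ : L2Spinor)).norm.add
        (Lp.memLp (𝓕 η : L2Spinor)).norm) hmeas ?_
      filter_upwards [h] with ξ hξ
      rw [norm_smul, Pi.add_apply, hξ, norm_smul]
      refine le_trans ?_ (le_abs_self _)
      rw [← one_add_mul]
      gcongr
      have h1 : (1 + ‖ξ‖ ^ 2) ^ ((1 : ℝ) / 2) ≤ 1 + ‖ξ‖ := by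
        rw [← Real.sqrt_eq_rpow]
        exact Real.sqrt_le_iff.mpr ⟨by positivity, by nlinarith [norm_nonneg ξ]⟩
      have h2 : ‖2 * (Real.pi : ℂ) * Complex.I * (ξ : ℂ)‖ = 2 * Real.pi * ‖ξ‖ := by
        simp [abs_of_pos Real.pi_pos]
      rw [h2, Complex.norm_real, Real.norm_of_nonneg (by positivity)]
      nlinarith [norm_nonneg ξ, Real.pi_gt_three]
    refine ⟨hmem.toLp, ?_⟩
    rw [Lp.fourier_toTemperedDistribution_eq, smulLeftCLM_eq_iff (by fun_prop)]
    exact hmem.coeFn_toLp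
  refine ⟨hψ, ?_⟩
  apply toTemperedDistribution_injective
  simp only
  rw [← derivH1_spec, (lineDeriv_eq_iff ψ η).mpr h]

/-- The Fourier transform commutes with a constant linear map of `ℂ²`. -/
theorem fourier_compLp (L : Spinor →L[ℂ] Spinor) (f : L2Spinor) :
    (𝓕 (L.compLp f) : L2Spinor) = L.compLp (𝓕 f : L2Spinor) := by
  have key : ∀ (f : L2Spinor) (g : 𝓢(ℝ, ℂ)), ((L.compLp f : L2Spinor) : 𝓢'(ℝ, Spinor)) g =
      L ((f : 𝓢'(ℝ, Spinor)) g) := fun f g => by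
    rw [Lp.toTemperedDistribution_apply, Lp.toTemperedDistribution_apply,
      ← ContinuousLinearMap.integral_comp_comm]
    · refine integral_congr_ae ?_
      filter_upwards [L.coeFn_compLp f] with x hx
      rw [hx, map_smul]
    · have hg := g.memLp 2 (volume : Measure ℝ)
      exact memLp_one_iff_integrable.mp ((Lp.memLp f).smul hg)
  apply toTemperedDistribution_injective
  ext1 g
  simp only
  rw [key, ← Lp.fourier_toTemperedDistribution_eq, ← Lp.fourier_toTemperedDistribution_eq]
  exact key f (𝓕 g)

/-- An `L²` function whose Fourier transform is an integrable function `h` is given by the inverse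
Fourier integral of `h`. -/
theorem ae_eq_fourierInv {ψ : L2Spinor} {h : ℝ → Spinor} (hh : Integrable h)
    (hψ : (𝓕 ψ : L2Spinor) =ᵐ[volume] h) : ψ =ᵐ[volume] (𝓕⁻ h : ℝ → Spinor) := by
  have hcont : Continuous (𝓕⁻ h : ℝ → Spinor) := by
    rw [← Real.Lp.fourierTransformInv_toLp (memLp_one_iff_integrable.mpr hh)]
    exact (Real.Lp.fourierTransformInv _).continuous
  refine ae_eq_of_forall_schwartz ((Lp.memLp ψ).locallyIntegrable one_le_two)
    hcont.locallyIntegrable fun g => ?_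
  have e₁ : ((𝓕⁻ (𝓕 (ψ : 𝓢'(ℝ, Spinor))) : 𝓢'(ℝ, Spinor))) g = ∫ x, g x • ψ x := by
    rw [FourierTransform.fourierInv_fourier_eq, Lp.toTemperedDistribution_apply]
  rw [← e₁, fourierInv_apply, Lp.fourier_toTemperedDistribution_eq,
    Lp.toTemperedDistribution_apply]
  have e₂ : ∫ x, (𝓕⁻ g : 𝓢(ℝ, ℂ)) x • (𝓕 ψ : L2Spinor) x =
      ∫ x, (𝓕⁻ (g : ℝ → ℂ)) x • h x := by
    refine integral_congr_ae ?_
    filter_upwards [hψ] with x hx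
    rw [hx, SchwartzMap.fourierInv_coe]
  rw [e₂]
  have hneg : Continuous fun p : ℝ × ℝ => (-innerₗ ℝ : ℝ →ₗ[ℝ] ℝ →ₗ[ℝ] ℝ) p.1 p.2 := by
    have : Continuous fun p : ℝ × ℝ => -(inner ℝ p.1 p.2) := by fun_prop
    exact this
  have := VectorFourier.integral_fourierIntegral_smul_eq_flip (L := -innerₗ ℝ) (μ := volume)
    (ν := volume) Real.continuous_fourierChar hneg g.integrable hh
  have e₃ : (-innerₗ ℝ : ℝ →ₗ[ℝ] ℝ →ₗ[ℝ] ℝ).flip = -innerₗ ℝ := by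
    ext; simp
  rw [e₃] at this
  exact this

/-! ### Dirac operators with a bounded potential -/

/-- A `2 × 2` matrix as a linear map of `ℂ²`. -/
abbrev matCLM (M : Matrix (Fin 2) (Fin 2) ℂ) : Spinor →L[ℂ] Spinor :=
  Matrix.toEuclideanCLM (𝕜 := ℂ) M

theorem mulFun_eq (V : ℝ → Matrix (Fin 2) (Fin 2) ℂ) (ψ : L2Spinor) (x : ℝ) :
    mulFun V ψ x = matCLM (V x) (ψ x) := by
  rw [mulFun, ← Matrix.coe_toEuclideanCLM_eq_toEuclideanLin]
  rfl

theorem operator_domain {V : ℝ → Matrix (Fin 2) (Fin 2) ℂ} (hV : IsBddMul fun x => matCLM (V x)) :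
    (operator V).domain = sobolevH1 := by
  change sobolevH1 ⊓ mulDomain V = sobolevH1
  refine inf_eq_left.mpr fun ψ _ => ?_
  change MemLp (mulFun V ψ) 2 volume
  rw [funext (mulFun_eq V ψ)]
  exact hV.memLp ψ

theorem operator_apply {V : ℝ → Matrix (Fin 2) (Fin 2) ℂ} (hV : IsBddMul fun x => matCLM (V x))
    (ψ : L2Spinor) (h : ψ ∈ (operator V).domain) (h' : ψ ∈ sobolevH1) :
    operator V ⟨ψ, h⟩ = (matCLM J₀).compLp (derivH1 ⟨ψ, h'⟩) + mulCLM _ hV ψ := by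
  change (matCLM J₀).compLp (derivH1 ⟨ψ, h'⟩) + _ = _
  congr 1

theorem inner_matCLM_left (M : Matrix (Fin 2) (Fin 2) ℂ) (a b : Spinor) :
    inner ℂ (matCLM M a) b = inner ℂ a (matCLM M.conjTranspose b) := by
  have : matCLM M.conjTranspose = ContinuousLinearMap.adjoint (matCLM M) := by
    rw [← ContinuousLinearMap.star_eq_adjoint, ← map_star]
    rfl
  rw [this, ContinuousLinearMap.adjoint_inner_right]

theorem inner_mulCLM_of_isHermitian {V : ℝ → Matrix (Fin 2) (Fin 2) ℂ}
    (hV : IsBddMul fun x => matCLM (V x)) (hH : ∀ x, (V x).IsHermitian) (f g : L2Spinor) :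
    inner ℂ (mulCLM _ hV f) g = inner ℂ f (mulCLM _ hV g) := by
  rw [L2.inner_def, L2.inner_def]
  refine integral_congr_ae ?_
  filter_upwards [coeFn_mulCLM hV f, coeFn_mulCLM hV g] with x h1 h2
  rw [h1, h2, inner_matCLM_left, (hH x).eq]

/-- On the Fourier side, symmetry of `J₀ ∂ₓ` is hermiticity of `2πiξ J₀`. -/
theorem inner_kinetic (ψ χ : sobolevH1) :
    inner ℂ ((matCLM J₀).compLp (derivH1 ψ)) (χ : L2Spinor) =
      inner ℂ (ψ : L2Spinor) ((matCLM J₀).compLp (derivH1 χ)) := by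
  rw [← Lp.inner_fourier_eq, ← Lp.inner_fourier_eq (ψ : L2Spinor), fourier_compLp, fourier_compLp,
    L2.inner_def, L2.inner_def]
  refine integral_congr_ae ?_
  filter_upwards [(matCLM J₀).coeFn_compLp (𝓕 (derivH1 ψ) : L2Spinor),
    (matCLM J₀).coeFn_compLp (𝓕 (derivH1 χ) : L2Spinor), fourier_derivH1 ψ, fourier_derivH1 χ]
    with x h1 h2 h3 h4
  have hJ : J₀.conjTranspose = -J₀ := by
    ext i j
    fin_cases i <;> fin_cases j <;> simp [J₀]
  have hJ' : matCLM (-J₀) = -matCLM J₀ := map_neg _ _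
  rw [h1, h2, h3, h4, inner_matCLM_left, hJ, hJ', map_smul, inner_smul_right, inner_smul_left,
    neg_apply, inner_neg_right]
  simp [Complex.conj_ofNat]

theorem isSymm_operator {V : ℝ → Matrix (Fin 2) (Fin 2) ℂ} (hV : IsBddMul fun x => matCLM (V x))
    (hH : ∀ x, (V x).IsHermitian) : UnboundedOperator.IsSymm (operator V) := by
  rintro ⟨x, hx⟩ ⟨y, hy⟩
  have hx' : x ∈ sobolevH1 := operator_domain hV ▸ hx
  have hy' : y ∈ sobolevH1 := operator_domain hV ▸ hy
  rw [operator_apply hV x hx hx', operator_apply hV y hy hy', inner_add_left, inner_add_right,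
    inner_mulCLM_of_isHermitian hV hH]
  exact congrArg (· + _) (inner_kinetic ⟨x, hx'⟩ ⟨y, hy'⟩)

/-! ### Fourier multipliers -/

/-- The Fourier multiplier with a bounded measurable matrix symbol. -/
def fourierMul (A : ℝ → Spinor →L[ℂ] Spinor) (hA : IsBddMul A) : L2Spinor →L[ℂ] L2Spinor :=
  ((Lp.fourierTransformₗᵢ ℝ Spinor).symm.toContinuousLinearEquiv : L2Spinor →L[ℂ] L2Spinor) ∘L
    mulCLM A hA ∘L
    ((Lp.fourierTransformₗᵢ ℝ Spinor).toContinuousLinearEquiv : L2Spinor →L[ℂ] L2Spinor)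

theorem fourier_fourierMul {A : ℝ → Spinor →L[ℂ] Spinor} (hA : IsBddMul A) (f : L2Spinor) :
    (𝓕 (fourierMul A hA f) : L2Spinor) = mulCLM A hA (𝓕 f : L2Spinor) :=
  (Lp.fourierTransformₗᵢ ℝ Spinor).apply_symm_apply _

theorem coeFn_fourier_fourierMul {A : ℝ → Spinor →L[ℂ] Spinor} (hA : IsBddMul A) (f : L2Spinor) :
    (𝓕 (fourierMul A hA f) : L2Spinor) =ᵐ[volume] fun ξ => A ξ ((𝓕 f : L2Spinor) ξ) := by
  rw [fourier_fourierMul]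
  exact coeFn_mulCLM hA _

theorem fourier_injective : Function.Injective (fun f : L2Spinor => (𝓕 f : L2Spinor)) :=
  (Lp.fourierTransformₗᵢ ℝ Spinor).injective

theorem ext_fourier {f g : L2Spinor} (h : (𝓕 f : L2Spinor) =ᵐ[volume] (𝓕 g : L2Spinor)) : f = g :=
  fourier_injective (Lp.ext h)

/-! ### The free operator -/

/-- The limit of the potentials at infinity. -/
def Vlim (ω : ℝ) : Matrix (Fin 2) (Fin 2) ℂ := !![((1 - ω : ℝ) : ℂ), 0; 0, ((-(1 + ω) : ℝ) : ℂ)]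

/-- The Pauli matrix `σ₃`, the mass term of the free operator. -/
def σ₃ : Matrix (Fin 2) (Fin 2) ℂ := !![1, 0; 0, -1]

/-- The Fourier symbol `2πiξ J₀ + σ₃` of the free operator with `ω = 0`. -/
def freeSymbol (ξ : ℝ) : Spinor →L[ℂ] Spinor :=
  (2 * Real.pi * Complex.I * (ξ : ℂ)) • matCLM J₀ + matCLM σ₃

/-- `(2πξ)²`, as a complex number. -/
def ksq (ξ : ℝ) : ℂ := (((2 * Real.pi * ξ) ^ 2 : ℝ) : ℂ)

/-- `J₀² = -1`, `σ₃² = 1` and `J₀ σ₃ = -σ₃ J₀`, so the square of the symbol is scalar; this makes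
its resolvent explicit. -/
theorem freeSymbol_comp_self (ξ : ℝ) :
    freeSymbol ξ * freeSymbol ξ = (1 + ksq ξ) • 1 := by
  have h1 : matCLM J₀ * matCLM J₀ = -1 := by
    rw [← map_mul, ← map_one (Matrix.toEuclideanCLM (n := Fin 2) (𝕜 := ℂ)), ← map_neg]
    congr 1
    ext i j
    fin_cases i <;> fin_cases j <;> simp [J₀]
  have h2 : matCLM σ₃ * matCLM σ₃ = 1 := by
    rw [← map_mul, ← map_one (Matrix.toEuclideanCLM (n := Fin 2) (𝕜 := ℂ))]
    congr 1
    ext i j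
    fin_cases i <;> fin_cases j <;> simp [σ₃]
  have h3 : matCLM J₀ * matCLM σ₃ = -(matCLM σ₃ * matCLM J₀) := by
    rw [← map_mul, ← map_mul, ← map_neg]
    congr 1
    ext i j
    fin_cases i <;> fin_cases j <;> simp [J₀, σ₃]
  have hc : (2 * Real.pi * Complex.I * (ξ : ℂ)) * (2 * Real.pi * Complex.I * (ξ : ℂ)) = -ksq ξ := by
    rw [ksq]
    push_cast
    linear_combination (4 * (Real.pi : ℂ) ^ 2 * (ξ : ℂ) ^ 2) * Complex.I_mul_I
  rw [freeSymbol, add_mul, mul_add, mul_add, smul_mul_smul_comm, h1, h2, hc, smul_mul_assoc,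
    mul_smul_comm, h3]
  module

theorem freeSymbol_sub_mul_add (ξ : ℝ) (s : ℂ) :
    (freeSymbol ξ - s • 1) * (freeSymbol ξ + s • 1) = (1 + ksq ξ - s ^ 2) • 1 := by
  rw [sub_mul, mul_add, mul_add, freeSymbol_comp_self, mul_smul_one, smul_one_mul,
    smul_mul_smul_comm, one_mul]
  module

theorem freeSymbol_add_mul_sub (ξ : ℝ) (s : ℂ) :
    (freeSymbol ξ + s • 1) * (freeSymbol ξ - s • 1) = (1 + ksq ξ - s ^ 2) • 1 := by
  rw [add_mul, mul_sub, mul_sub, freeSymbol_comp_self, mul_smul_one, smul_one_mul,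
    smul_mul_smul_comm, one_mul]
  module

theorem continuous_freeSymbol : Continuous freeSymbol := by
  unfold freeSymbol
  fun_prop

theorem continuous_ksq : Continuous ksq := by
  unfold ksq
  fun_prop

theorem norm_freeSymbol_le (ξ : ℝ) :
    ‖freeSymbol ξ‖ ≤ (‖matCLM J₀‖ + ‖matCLM σ₃‖) * (1 + 2 * Real.pi * |ξ|) := by
  have h : ‖2 * (Real.pi : ℂ) * Complex.I * (ξ : ℂ)‖ = 2 * Real.pi * |ξ| := by
    simp [abs_of_pos Real.pi_pos]
  refine (norm_add_le _ _).trans ?_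
  rw [norm_smul, h]
  have : 0 ≤ 2 * Real.pi * |ξ| := by positivity
  nlinarith [norm_nonneg (matCLM J₀), norm_nonneg (matCLM σ₃)]

theorem isBddMul_Vlim (ω : ℝ) : IsBddMul fun _ : ℝ => matCLM (Vlim ω) :=
  ⟨aestronglyMeasurable_const, _, norm_nonneg _, fun _ => le_rfl⟩

/-- The free operator `J₀ ∂ₓ + diag(1 - ω, -1 - ω)`. -/
abbrev freeOperator (ω : ℝ) : L2Spinor →ₗ.[ℂ] L2Spinor := operator fun _ => Vlim ω

/-- The Fourier transform turns `H₀ - z` into multiplication by `σ₃ + 2πiξ J₀ - (z + ω)`. -/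
theorem fourier_freeOperator_sub (ω : ℝ) (z : ℂ) (ψ : L2Spinor) (h : ψ ∈ (freeOperator ω).domain) :
    (𝓕 (freeOperator ω ⟨ψ, h⟩ - z • ψ) : L2Spinor) =ᵐ[volume]
      fun ξ => (freeSymbol ξ - (z + ω) • 1) ((𝓕 ψ : L2Spinor) ξ) := by
  have h' : ψ ∈ sobolevH1 := operator_domain (isBddMul_Vlim ω) ▸ h
  have e : freeOperator ω ⟨ψ, h⟩ - z • ψ =
      (matCLM J₀).compLp (derivH1 ⟨ψ, h'⟩) + (matCLM (Vlim ω - z • 1)).compLp ψ := by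
    rw [operator_apply (isBddMul_Vlim ω) ψ h h', add_sub_assoc]
    congr 1
    refine Lp.ext ?_
    filter_upwards [Lp.coeFn_sub (mulCLM _ (isBddMul_Vlim ω) ψ) (z • ψ), Lp.coeFn_smul z ψ,
      coeFn_mulCLM (isBddMul_Vlim ω) ψ, (matCLM (Vlim ω - z • 1)).coeFn_compLp ψ] with x h1 h2 h3 h4
    rw [h1, h4, Pi.sub_apply, h2, h3, Pi.smul_apply]
    simp
  rw [e, FourierTransform.fourier_add, fourier_compLp, fourier_compLp]
  have hM : matCLM (Vlim ω - z • 1) = matCLM σ₃ - (z + ω) • 1 := by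
    rw [← map_one (Matrix.toEuclideanCLM (n := Fin 2) (𝕜 := ℂ)), ← map_smul, ← map_sub]
    congr 1
    ext i j
    fin_cases i <;> fin_cases j <;> simp [Vlim, σ₃] <;> ring
  filter_upwards [Lp.coeFn_add ((matCLM J₀).compLp (𝓕 (derivH1 ⟨ψ, h'⟩) : L2Spinor))
      ((matCLM (Vlim ω - z • 1)).compLp (𝓕 ψ : L2Spinor)),
    (matCLM J₀).coeFn_compLp (𝓕 (derivH1 ⟨ψ, h'⟩) : L2Spinor),
    (matCLM (Vlim ω - z • 1)).coeFn_compLp (𝓕 ψ : L2Spinor), fourier_derivH1 ⟨ψ, h'⟩]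
    with x h1 h2 h3 h4
  rw [h1, Pi.add_apply, h2, h3, h4, hM, freeSymbol, map_smul, add_sub_assoc, add_apply]
  rfl

/-! ### The spectrum of the free operator -/

/-- Off the ray `[1, ∞)` of values of `1 + (2πξ)²`, the determinant `1 + (2πξ)² - w` grows at least
like `1 + (2πξ)²`. -/
theorem exists_le_mul_norm_of_notMem {w : ℂ} (hw : w ∉ Complex.ofReal '' Set.Ici 1) :
    ∃ C, 0 ≤ C ∧ ∀ ξ : ℝ, 1 + (2 * Real.pi * ξ) ^ 2 ≤ C * ‖1 + ksq ξ - w‖ := by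
  have hc : IsClosed (Complex.ofReal '' Set.Ici 1) :=
    Complex.isometry_ofReal.isClosedEmbedding.isClosedMap _ isClosed_Ici
  obtain ⟨ε, hε, hball⟩ := Metric.isOpen_iff.mp hc.isOpen_compl w hw
  have hlow : ∀ ξ : ℝ, ε ≤ ‖1 + ksq ξ - w‖ := fun ξ => by
    by_contra! hlt
    have hmem : ((1 + (2 * Real.pi * ξ) ^ 2 : ℝ) : ℂ) ∈ Metric.ball w ε := by
      rw [Metric.mem_ball, dist_eq_norm]
      simpa [ksq] using hlt
    exact hball hmem ⟨_, le_add_of_nonneg_right (a := (1 : ℝ)) (sq_nonneg _), rfl⟩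
  refine ⟨1 + ‖w‖ / ε, by positivity, fun ξ => ?_⟩
  have h1 : 1 + (2 * Real.pi * ξ) ^ 2 ≤ ‖1 + ksq ξ - w‖ + ‖w‖ := by
    have : ‖1 + ksq ξ‖ = 1 + (2 * Real.pi * ξ) ^ 2 := by
      rw [ksq, ← Complex.ofReal_one, ← Complex.ofReal_add, Complex.norm_real,
        Real.norm_of_nonneg (by positivity)]
    rw [← this]
    exact norm_le_norm_sub_add _ _
  have h2 : ‖w‖ ≤ ‖w‖ / ε * ‖1 + ksq ξ - w‖ := by
    rw [div_mul_eq_mul_div, le_div_iff₀ hε]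
    gcongr
    exact hlow ξ
  linarith

/-- The symbol `(σ₃ + 2πiξ J₀ - s)⁻¹` of the free resolvent. -/
def resolventSymbol (s : ℂ) (ξ : ℝ) : Spinor →L[ℂ] Spinor :=
  (1 + ksq ξ - s ^ 2)⁻¹ • (freeSymbol ξ + s • 1)

theorem det_ne_zero {s : ℂ} (hs : s ^ 2 ∉ Complex.ofReal '' Set.Ici 1) (ξ : ℝ) :
    1 + ksq ξ - s ^ 2 ≠ 0 := by
  intro h
  refine hs ⟨1 + (2 * Real.pi * ξ) ^ 2, le_add_of_nonneg_right (a := (1 : ℝ)) (sq_nonneg _), ?_⟩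
  rw [← sub_eq_zero.mp h, ksq]
  push_cast
  rfl

theorem freeSymbol_sub_mul_resolventSymbol {s : ℂ} (hs : s ^ 2 ∉ Complex.ofReal '' Set.Ici 1)
    (ξ : ℝ) : (freeSymbol ξ - s • 1) * resolventSymbol s ξ = 1 := by
  rw [resolventSymbol, mul_smul_comm, freeSymbol_sub_mul_add, inv_smul_smul₀ (det_ne_zero hs ξ)]

theorem resolventSymbol_mul_freeSymbol_sub {s : ℂ} (hs : s ^ 2 ∉ Complex.ofReal '' Set.Ici 1)
    (ξ : ℝ) : resolventSymbol s ξ * (freeSymbol ξ - s • 1) = 1 := by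
  rw [resolventSymbol, smul_mul_assoc, freeSymbol_add_mul_sub, inv_smul_smul₀ (det_ne_zero hs ξ)]

/-- The free resolvent gains one derivative. -/
theorem exists_norm_resolventSymbol_le {s : ℂ} (hs : s ^ 2 ∉ Complex.ofReal '' Set.Ici 1) :
    ∃ C, 0 ≤ C ∧ ∀ ξ, (1 + 2 * Real.pi * |ξ|) * ‖resolventSymbol s ξ‖ ≤ C := by
  obtain ⟨C, hC0, hC⟩ := exists_le_mul_norm_of_notMem hs
  set B := ‖matCLM J₀‖ + ‖matCLM σ₃‖ with hB
  have hB0 : 0 ≤ B := by positivity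
  refine ⟨2 * (B + ‖s‖) * C, by positivity, fun ξ => ?_⟩
  have hd : 0 < ‖1 + ksq ξ - s ^ 2‖ := norm_pos_iff.mpr (det_ne_zero hs ξ)
  have h1 : ‖freeSymbol ξ + s • (1 : Spinor →L[ℂ] Spinor)‖ ≤
      (B + ‖s‖) * (1 + 2 * Real.pi * |ξ|) := by
    refine (norm_add_le _ _).trans ?_
    have h2 := norm_freeSymbol_le ξ
    have h3 : ‖s • (1 : Spinor →L[ℂ] Spinor)‖ ≤ ‖s‖ := by
      rw [norm_smul]
      exact mul_le_of_le_one_right (norm_nonneg _) ContinuousLinearMap.norm_id_le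
    have h4 : 0 ≤ ‖s‖ * (2 * Real.pi * |ξ|) := by positivity
    linarith
  rw [resolventSymbol, norm_smul, norm_inv, mul_left_comm, inv_mul_le_iff₀ hd]
  have h5 : (1 + 2 * Real.pi * |ξ|) ^ 2 ≤ 2 * (1 + (2 * Real.pi * ξ) ^ 2) := by
    have : (2 * Real.pi * ξ) ^ 2 = (2 * Real.pi * |ξ|) ^ 2 := by rw [mul_pow, mul_pow _ |ξ|, sq_abs]
    rw [this]
    nlinarith [sq_nonneg (1 - 2 * Real.pi * |ξ|)]
  calc (1 + 2 * Real.pi * |ξ|) * ‖freeSymbol ξ + s • (1 : Spinor →L[ℂ] Spinor)‖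
      ≤ (1 + 2 * Real.pi * |ξ|) * ((B + ‖s‖) * (1 + 2 * Real.pi * |ξ|)) := by gcongr
    _ = (B + ‖s‖) * (1 + 2 * Real.pi * |ξ|) ^ 2 := by ring
    _ ≤ (B + ‖s‖) * (2 * (C * ‖1 + ksq ξ - s ^ 2‖)) := by
        gcongr
        exact h5.trans (by gcongr; exact hC ξ)
    _ = _ := by ring

theorem isBddMul_resolventSymbol {s : ℂ} (hs : s ^ 2 ∉ Complex.ofReal '' Set.Ici 1) :
    IsBddMul (resolventSymbol s) := by
  obtain ⟨C, hC0, hC⟩ := exists_norm_resolventSymbol_le hs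
  refine ⟨Continuous.aestronglyMeasurable ?_, C, hC0, fun ξ => le_trans ?_ (hC ξ)⟩
  · have h1 := continuous_freeSymbol
    have h2 : Continuous fun ξ => (1 + ksq ξ - s ^ 2)⁻¹ :=
      ((continuous_const.add continuous_ksq).sub continuous_const).inv₀ (det_ne_zero hs)
    exact h2.smul (h1.add continuous_const)
  · refine le_mul_of_one_le_left (norm_nonneg _) (le_add_of_nonneg_right (by positivity))

theorem isBddMul_mul_resolventSymbol {s : ℂ} (hs : s ^ 2 ∉ Complex.ofReal '' Set.Ici 1) :
    IsBddMul fun ξ => (2 * Real.pi * Complex.I * (ξ : ℂ)) • resolventSymbol s ξ := by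
  obtain ⟨C, hC0, hC⟩ := exists_norm_resolventSymbol_le hs
  have hc : Continuous fun ξ : ℝ => 2 * (Real.pi : ℂ) * Complex.I * (ξ : ℂ) := by fun_prop
  refine ⟨hc.aestronglyMeasurable.smul (isBddMul_resolventSymbol hs).1, C, hC0,
    fun ξ => le_trans ?_ (hC ξ)⟩
  rw [norm_smul]
  gcongr
  simp [abs_of_pos Real.pi_pos]

/-- The free resolvent `(H₀ - z)⁻¹`, with `s = z + ω`. -/
theorem freeResolvent_spec (ω : ℝ) {z : ℂ} (hs : (z + ω) ^ 2 ∉ Complex.ofReal '' Set.Ici 1) :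
    (∀ y, ∃ h : fourierMul _ (isBddMul_resolventSymbol hs) y ∈ (freeOperator ω).domain,
      freeOperator ω ⟨_, h⟩ - z • fourierMul _ (isBddMul_resolventSymbol hs) y = y) ∧
    ∀ x : (freeOperator ω).domain, fourierMul _ (isBddMul_resolventSymbol hs)
      (freeOperator ω x - z • (x : L2Spinor)) = x := by
  refine ⟨fun y => ?_, fun x => ?_⟩
  · set ψ := fourierMul _ (isBddMul_resolventSymbol hs) y with hψ
    have hψ' : ψ ∈ sobolevH1 := by
      refine (exists_derivH1_eq (η := fourierMul _ (isBddMul_mul_resolventSymbol hs) y) ?_).1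
      filter_upwards [coeFn_fourier_fourierMul (isBddMul_mul_resolventSymbol hs) y,
        coeFn_fourier_fourierMul (isBddMul_resolventSymbol hs) y] with ξ h1 h2
      rw [h1, h2]
      rfl
    have h : ψ ∈ (freeOperator ω).domain := (operator_domain (isBddMul_Vlim ω)).symm ▸ hψ'
    refine ⟨h, ext_fourier ?_⟩
    filter_upwards [fourier_freeOperator_sub ω z ψ h,
      coeFn_fourier_fourierMul (isBddMul_resolventSymbol hs) y] with ξ h1 h2
    rw [h1, h2, ← mul_apply_eq_comp, freeSymbol_sub_mul_resolventSymbol hs,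
      one_apply_eq_self]
  · refine ext_fourier ?_
    filter_upwards [fourier_freeOperator_sub ω z x x.2,
      coeFn_fourier_fourierMul (isBddMul_resolventSymbol hs)
        (freeOperator ω x - z • (x : L2Spinor))]
      with ξ h1 h2
    rw [h2, h1, ← mul_apply_eq_comp, resolventSymbol_mul_freeSymbol_sub hs,
      one_apply_eq_self]

theorem mem_resolventSet_freeOperator (ω : ℝ) {z : ℂ}
    (hs : (z + ω) ^ 2 ∉ Complex.ofReal '' Set.Ici 1) : z ∈ resolventSet (freeOperator ω) :=
  ⟨_, freeResolvent_spec ω hs⟩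

/-- The free operator has no eigenvalues: `det (σ₃ + 2πiξ J₀ - s)` vanishes for at most two `ξ`. -/
theorem eigenspace_freeOperator (ω : ℝ) (z : ℂ) : eigenspace (freeOperator ω) z = ⊥ := by
  refine (Submodule.eq_bot_iff _).mpr fun x hx => ?_
  have hx' : freeOperator ω x - z • (x : L2Spinor) = 0 := sub_eq_zero.mpr (mem_eigenspace.mp hx)
  have h0 := fourier_freeOperator_sub ω z x x.2
  simp only [Subtype.coe_eta] at h0
  rw [hx', FourierTransform.fourier_zero] at h0
  have hfin : {ξ : ℝ | 1 + ksq ξ - (z + ω) ^ 2 = 0}.Finite := by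
    by_cases hne : ∃ ξ₀ : ℝ, 1 + ksq ξ₀ - (z + ω) ^ 2 = 0
    · obtain ⟨ξ₀, hξ₀⟩ := hne
      refine (Set.toFinite {ξ₀, -ξ₀}).subset fun ξ hξ => ?_
      have : ksq ξ = ksq ξ₀ := by 
        have hξ' : 1 + ksq ξ - (z + ω) ^ 2 = 0 := hξ
        linear_combination hξ' - hξ₀
      rw [ksq, ksq, Complex.ofReal_inj, mul_pow, mul_pow _ ξ₀] at this
      exact sq_eq_sq_iff_eq_or_eq_neg.mp (mul_left_cancel₀ (by positivity) this)
    · push Not at hne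
      convert Set.finite_empty
      ext ξ
      simpa using hne ξ
  have hae : ∀ᵐ ξ : ℝ, ξ ∉ {ξ : ℝ | 1 + ksq ξ - (z + ω) ^ 2 = 0} :=
    hfin.countable.ae_notMem _
  have : (x : L2Spinor) = 0 := by
    refine ext_fourier ?_
    rw [FourierTransform.fourier_zero]
    filter_upwards [h0, hae, Lp.coeFn_zero Spinor 2 (volume : Measure ℝ)] with ξ h1 h2 h3
    rw [h3, Pi.zero_apply] at h1 ⊢
    have h4 := congrArg (freeSymbol ξ + (z + ω) • 1 : Spinor →L[ℂ] Spinor) h1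
    rw [map_zero, ← mul_apply_eq_comp, freeSymbol_add_mul_sub, smul_apply,
      one_apply_eq_self] at h4
    exact (smul_eq_zero.mp h4.symm).resolve_left h2
  exact Subtype.ext this

/-- Where `det (σ₃ + 2πiξ₀ J₀ - s) = 0`, a function whose Fourier transform is concentrated near
`ξ₀` shows that the free resolvent would be unbounded. -/
theorem notMem_resolventSet_freeOperator (ω : ℝ) {t : ℝ} (ht : 1 ≤ |t + ω|) :
    (t : ℂ) ∉ resolventSet (freeOperator ω) := by
  rintro ⟨R, -, hR⟩
  set s : ℝ := t + ω with hs
  have hs1 : 1 ≤ s ^ 2 := by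
    rw [← sq_abs]
    nlinarith
  set ξ₀ : ℝ := √(s ^ 2 - 1) / (2 * Real.pi) with hξ₀
  have hdet : 1 + ksq ξ₀ - (s : ℂ) ^ 2 = 0 := by
    have : (2 * Real.pi * ξ₀) ^ 2 = s ^ 2 - 1 := by
      rw [hξ₀, mul_div_cancel₀ _ (by positivity), Real.sq_sqrt (by linarith)]
    rw [ksq, this]
    push_cast
    ring
  -- `σ₃ + s` is `diag(1 + s, s - 1)`, and one of the entries has modulus at least `1`. The
  -- off-diagonal matrix `J₀` does not affect the `i`-th component of the symbol applied to `eᵢ`.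
  obtain ⟨i, hi⟩ : ∃ i : Fin 2, 1 ≤ ‖(matCLM σ₃ (EuclideanSpace.single i 1) +
      (s : ℂ) • EuclideanSpace.single i (1 : ℂ) : Spinor) i‖ := by
    rcases le_total 0 s with h | h
    · refine ⟨0, ?_⟩
      have e : (matCLM σ₃ (EuclideanSpace.single 0 1) +
          (s : ℂ) • EuclideanSpace.single 0 (1 : ℂ) : Spinor) 0 = ((1 + s : ℝ) : ℂ) := by
        simp [matCLM, Matrix.ofLp_toEuclideanCLM, σ₃]
      rw [e, Complex.norm_real, Real.norm_of_nonneg (by linarith)]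
      linarith
    · refine ⟨1, ?_⟩
      have e : (matCLM σ₃ (EuclideanSpace.single 1 1) +
          (s : ℂ) • EuclideanSpace.single 1 (1 : ℂ) : Spinor) 1 = ((-1 + s : ℝ) : ℂ) := by
        simp [matCLM, Matrix.ofLp_toEuclideanCLM, σ₃]
      rw [e, Complex.norm_real, Real.norm_of_nonpos (by linarith)]
      linarith
  set e : Spinor := EuclideanSpace.single i 1 with he
  have hlow : ∀ ξ, 1 ≤ ‖(freeSymbol ξ + (s : ℂ) • 1) e‖ := fun ξ => by
    refine le_trans ?_ (PiLp.norm_apply_le _ i)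
    have e0 : (matCLM J₀ e) i = 0 := by
      rw [he]
      fin_cases i <;> simp [matCLM, Matrix.ofLp_toEuclideanCLM, J₀]
    have e1 : ((freeSymbol ξ + (s : ℂ) • 1) e) i = (matCLM σ₃ e + (s : ℂ) • e : Spinor) i := by
      rw [freeSymbol]
      simp [e0]
    rw [e1]
    exact hi
  set ε : ℝ := 1 / (2 * (‖R‖ + 1)) with hε
  have hε0 : 0 < ε := by positivity
  have hcont : Continuous fun ξ => 1 + ksq ξ - (s : ℂ) ^ 2 :=
    (continuous_const.add continuous_ksq).sub continuous_const
  obtain ⟨δ, hδ, hball⟩ := Metric.continuous_iff.mp hcont ξ₀ ε hε0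
  set S : Set ℝ := Metric.ball ξ₀ δ with hS
  have hSm : MeasurableSet S := Metric.isOpen_ball.measurableSet
  have hSf : volume S ≠ ⊤ := Metric.isBounded_ball.measure_lt_top.ne
  have hSpos : 0 < volume.real S := by
    rw [measureReal_def]
    exact ENNReal.toReal_pos (Metric.measure_ball_pos volume ξ₀ hδ).ne' hSf
  have hmem : ∀ m : ℝ → Spinor, Continuous m → MemLp (S.indicator m) 2 volume := fun m hm =>
    memLp_indicator_of_continuous hSm Metric.isBounded_ball hm
  have hm₁ : Continuous fun ξ => (freeSymbol ξ + (s : ℂ) • 1) e := by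
    have := continuous_freeSymbol
    fun_prop
  have hm₂ : Continuous fun ξ : ℝ => (2 * Real.pi * Complex.I * (ξ : ℂ)) •
      (freeSymbol ξ + (s : ℂ) • 1) e := by fun_prop
  -- `(σ₃ + 2πiξ J₀ + s) e` is mapped by `σ₃ + 2πiξ J₀ - s` to `(1 + (2πξ)² - s²) e`, which is at
  -- most `ε` on `S`, while it is itself of length at least `1`.
  set ψ : L2Spinor := (𝓕⁻ ((hmem _ hm₁).toLp : L2Spinor) : L2Spinor) with hψ
  set η : L2Spinor := (𝓕⁻ ((hmem _ hm₂).toLp : L2Spinor) : L2Spinor) with hη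
  have hψF : (𝓕 ψ : L2Spinor) =ᵐ[volume] S.indicator fun ξ => (freeSymbol ξ + (s : ℂ) • 1) e := by
    rw [hψ, FourierTransform.fourier_fourierInv_eq]
    exact (hmem _ hm₁).coeFn_toLp
  have hηF : (𝓕 η : L2Spinor) =ᵐ[volume] S.indicator fun ξ : ℝ =>
      (2 * Real.pi * Complex.I * (ξ : ℂ)) • (freeSymbol ξ + (s : ℂ) • 1) e := by
    rw [hη, FourierTransform.fourier_fourierInv_eq]
    exact (hmem _ hm₂).coeFn_toLp
  have hψH : ψ ∈ sobolevH1 := by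
    refine (exists_derivH1_eq (η := η) ?_).1
    filter_upwards [hψF, hηF] with ξ h1 h2
    rw [h1, h2]
    by_cases hξ : ξ ∈ S
    · simp only [Set.indicator_of_mem hξ]
    · simp only [Set.indicator_of_notMem hξ, smul_zero]
  have hψD : ψ ∈ (freeOperator ω).domain := (operator_domain (isBddMul_Vlim ω)).symm ▸ hψH
  set h : L2Spinor := indicatorConstLp 2 hSm hSf e with hh
  have hnorm_e : ‖e‖ = 1 := by simp [he]
  have hhpos : 0 < ‖h‖ := by
    rw [hh, norm_indicatorConstLp two_ne_zero ENNReal.ofNat_ne_top, hnorm_e, one_mul]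
    positivity
  have hupper : ‖freeOperator ω ⟨ψ, hψD⟩ - (t : ℂ) • ψ‖ ≤ ε * ‖h‖ := by
    rw [← Lp.norm_fourier_eq]
    refine Lp.norm_le_mul_norm_of_ae_le_mul ?_
    filter_upwards [fourier_freeOperator_sub ω t ψ hψD, hψF, indicatorConstLp_coeFn (p := 2)
      (hs := hSm) (hμs := hSf) (c := e)] with ξ h1 h2 h3
    rw [h1, h2, hh, h3]
    by_cases hξ : ξ ∈ S
    · rw [Set.indicator_of_mem hξ, Set.indicator_of_mem hξ, ← Complex.ofReal_add,
        ← mul_apply_eq_comp, freeSymbol_sub_mul_add, smul_apply,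
        one_apply_eq_self, norm_smul]
      gcongr
      have := hball ξ hξ
      rw [hdet, dist_zero_right] at this
      exact this.le
    · simp [Set.indicator_of_notMem hξ]
  have hlower : ‖h‖ ≤ ‖ψ‖ := by
    rw [← Lp.norm_fourier_eq ψ]
    refine Lp.norm_le_norm_of_ae_le ?_
    filter_upwards [hψF, indicatorConstLp_coeFn (p := 2)
      (hs := hSm) (hμs := hSf) (c := e)] with ξ h2 h3
    rw [h2, hh, h3]
    by_cases hξ : ξ ∈ S
    · rw [Set.indicator_of_mem hξ, Set.indicator_of_mem hξ, hnorm_e]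
      exact hlow ξ
    · simp [Set.indicator_of_notMem hξ]
  have hfinal : ‖ψ‖ ≤ ‖R‖ * (ε * ‖h‖) := by
    have e1 := hR ⟨ψ, hψD⟩
    calc ‖ψ‖ = ‖R (freeOperator ω ⟨ψ, hψD⟩ - (t : ℂ) • ψ)‖ := by rw [e1]
      _ ≤ ‖R‖ * ‖freeOperator ω ⟨ψ, hψD⟩ - (t : ℂ) • ψ‖ := R.le_opNorm _
      _ ≤ _ := by gcongr
  have hRε : ‖R‖ * ε < 1 := by
    rw [hε, mul_one_div, div_lt_one (by positivity)]
    linarith [norm_nonneg R]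
  nlinarith

/-- The spectrum of the free operator is the set of `t` with `|t + ω| ≥ 1`. -/
theorem spectrum_freeOperator (ω : ℝ) : UnboundedOperator.spectrum (freeOperator ω) =
    Complex.ofReal '' (Set.univ \ Set.Ioo (-(1 + ω)) (1 - ω)) := by
  have habs : ∀ t : ℝ, t ∈ Set.univ \ Set.Ioo (-(1 + ω)) (1 - ω) ↔ 1 ≤ |t + ω| := fun t => by
    rw [← not_lt, abs_lt]
    simp only [Set.mem_sdiff, Set.mem_univ, true_and, Set.mem_Ioo, not_iff_not]
    constructor <;> rintro ⟨h1, h2⟩ <;> constructor <;> linarith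
  apply Set.Subset.antisymm
  · intro z hz
    by_contra hzn
    refine hz (mem_resolventSet_freeOperator ω ?_)
    rintro ⟨r, hr, hrz⟩
    have hr' : (1 : ℝ) ≤ r := hr
    have h2 : (z + ω) ^ 2 = ((√r : ℝ) : ℂ) ^ 2 := by
      rw [← hrz, ← Complex.ofReal_pow, Real.sq_sqrt (by linarith)]
    have h1 : 1 ≤ √r := Real.one_le_sqrt.mpr hr'
    rcases sq_eq_sq_iff_eq_or_eq_neg.mp h2 with h | h
    · refine hzn ⟨√r - ω, (habs _).mpr ?_, ?_⟩
      · rw [sub_add_cancel]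
        exact h1.trans (le_abs_self _)
      · push_cast
        rw [← h, add_sub_cancel_right]
    · refine hzn ⟨-√r - ω, (habs _).mpr ?_, ?_⟩
      · rw [sub_add_cancel, abs_neg]
        exact h1.trans (le_abs_self _)
      · push_cast
        rw [← h, add_sub_cancel_right]
  · rintro _ ⟨t, ht, rfl⟩
    exact notMem_resolventSet_freeOperator ω ((habs t).mp ht)

theorem isClosed_spectrum_freeOperator (ω : ℝ) :
    IsClosed (UnboundedOperator.spectrum (freeOperator ω)) := by
  rw [spectrum_freeOperator]
  refine Complex.isometry_ofReal.isClosedEmbedding.isClosedMap _ ?_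
  rw [← Set.compl_eq_univ_sdiff]
  exact isOpen_Ioo.isClosed_compl

theorem preperfect_spectrum_freeOperator (ω : ℝ) :
    Preperfect (UnboundedOperator.spectrum (freeOperator ω)) := by
  rw [spectrum_freeOperator]
  rintro _ ⟨t, ht, rfl⟩
  refine accPt_iff_nhds.mpr fun U hU => ?_
  obtain ⟨ε, hε, hball⟩ := Metric.mem_nhds_iff.mp hU
  have ht' : t ≤ -(1 + ω) ∨ 1 - ω ≤ t := by
    by_contra! h
    exact ht.2 h
  have key : ∀ d : ℝ, |d| = ε / 2 → t + d ∉ Set.Ioo (-(1 + ω)) (1 - ω) →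
      ∃ y ∈ U ∩ Complex.ofReal '' (Set.univ \ Set.Ioo (-(1 + ω)) (1 - ω)), y ≠ (t : ℂ) := by
    intro d hd hmem
    refine ⟨((t + d : ℝ) : ℂ), ⟨hball ?_, _, ⟨Set.mem_univ _, hmem⟩, rfl⟩, ?_⟩
    · rw [Metric.mem_ball, dist_eq_norm, ← Complex.ofReal_sub, Complex.norm_real, Real.norm_eq_abs,
        add_sub_cancel_left, hd]
      linarith
    · rw [Ne, Complex.ofReal_inj]
      intro h
      rw [add_eq_left.mp h, abs_zero] at hd
      linarith
  rcases ht' with h | h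
  · exact key (-(ε / 2)) (by rw [abs_neg, abs_of_pos (by linarith)]) fun hm => by
      linarith [hm.1]
  · exact key (ε / 2) (abs_of_pos (by linarith)) fun hm => by
      linarith [hm.2]

/-! ### Relative compactness of decaying potentials -/

/-- The characteristic function of `[-a, a]`, as a field of multiples of the identity. -/
def cutoff (a : ℝ) : ℝ → Spinor →L[ℂ] Spinor := (Set.Icc (-a) a).indicator fun _ => 1

theorem norm_cutoff_le (a x : ℝ) : ‖cutoff a x‖ ≤ 1 :=
  (norm_indicator_le_norm_self _ _).trans ContinuousLinearMap.norm_id_le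

theorem isBddMul_cutoff (a : ℝ) : IsBddMul (cutoff a) :=
  ⟨aestronglyMeasurable_const.indicator measurableSet_Icc, 1, zero_le_one, norm_cutoff_le a⟩

/-- The truncation of a continuous function to `[-a, a]`, as an element of `L²`. -/
def truncL2 (a : ℝ) {φ : ℝ → ℂ} (hφ : Continuous φ) : Lp ℂ 2 (volume : Measure ℝ) :=
  (memLp_indicator_of_continuous measurableSet_Icc (Metric.isBounded_Icc _ _) hφ :
    MemLp ((Set.Icc (-a) a).indicator φ) 2 volume).toLp

theorem coeFn_truncL2 (a : ℝ) {φ : ℝ → ℂ} (hφ : Continuous φ) :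
    truncL2 a hφ =ᵐ[volume] (Set.Icc (-a) a).indicator φ := MemLp.coeFn_toLp _

/-- The bounded bilinear map `(f, φ) ↦ ∫ φ f`. -/
def pairL2 : L2Spinor →L[ℂ] Lp ℂ 2 (volume : Measure ℝ) →L[ℂ] Spinor :=
  (ContinuousLinearMap.lsmul ℂ ℂ (E := Spinor)).flip.lpPairing volume 2 2

theorem pairL2_apply (f : L2Spinor) (φ : Lp ℂ 2 (volume : Measure ℝ)) :
    pairL2 f φ = ∫ x, φ x • f x :=
  ContinuousLinearMap.lpPairing_eq_integral _ _ _

/-- The operator `c ↦ φ c` from `ℂ²` to `L²(ℝ, ℂ²)`. -/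
def tensorL2 (φ : Lp ℂ 2 (volume : Measure ℝ)) : Spinor →L[ℂ] L2Spinor :=
  LinearMap.toContinuousLinearMap
    { toFun := fun c => (ContinuousLinearMap.toSpanSingleton ℂ c).compLp φ
      map_add' := fun c d => by
        rw [ContinuousLinearMap.toSpanSingleton_add, ContinuousLinearMap.add_compLp]
      map_smul' := fun r c => by
        rw [ContinuousLinearMap.toSpanSingleton_smul, ContinuousLinearMap.smul_compLp]
        rfl }

theorem coeFn_tensorL2 (φ : Lp ℂ 2 (volume : Measure ℝ)) (c : Spinor) :
    tensorL2 φ c =ᵐ[volume] fun x => φ x • c :=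
  (ContinuousLinearMap.toSpanSingleton ℂ c).coeFn_compLp φ

theorem continuous_fourierKernel (x : ℝ) :
    Continuous fun v : ℝ => Complex.exp (2 * Real.pi * Complex.I * ((x : ℂ) * v)) := by
  fun_prop

/-- A function whose Fourier transform is cut off to `[-a, a]` is given by a Fourier integral. -/
theorem coeFn_fourierMul_cutoff (a : ℝ) (f : L2Spinor) :
    fourierMul (cutoff a) (isBddMul_cutoff a) f =ᵐ[volume]
      fun x => pairL2 (𝓕 f : L2Spinor) (truncL2 a (continuous_fourierKernel x)) := by
  have hcut : ∀ ξ, cutoff a ξ ((𝓕 f : L2Spinor) ξ) =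
      (Set.Icc (-a) a).indicator (𝓕 f : L2Spinor) ξ := fun ξ => by
    by_cases h : ξ ∈ Set.Icc (-a) a <;> simp [cutoff, h]
  have hint : Integrable ((Set.Icc (-a) a).indicator (𝓕 f : L2Spinor)) := by
    rw [integrable_indicator_iff measurableSet_Icc]
    exact ((Lp.memLp (𝓕 f : L2Spinor)).locallyIntegrable one_le_two).integrableOn_isCompact
      isCompact_Icc
  have h1 := ae_eq_fourierInv hint (ψ := fourierMul (cutoff a) (isBddMul_cutoff a) f) (by
    filter_upwards [coeFn_fourier_fourierMul (isBddMul_cutoff a) f] with ξ h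
    rw [h, hcut])
  filter_upwards [h1] with x hx
  rw [hx, Real.fourierInv_eq', pairL2_apply]
  refine integral_congr_ae ?_
  filter_upwards [coeFn_truncL2 a (continuous_fourierKernel x)] with v hv
  rw [hv]
  by_cases h : v ∈ Set.Icc (-a) a
  · rw [Set.indicator_of_mem h, Set.indicator_of_mem h]
    congr 2
    simp only [RCLike.inner_apply, conj_trivial]
    push_cast
    ring
  · rw [Set.indicator_of_notMem h, Set.indicator_of_notMem h, smul_zero, zero_smul]

/-- The exponential series converges uniformly on discs. -/
theorem exists_norm_exp_sub_sum_le (r : ℝ) {ε : ℝ} (hε : 0 < ε) :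
    ∃ m : ℕ, ∀ z : ℂ, ‖z‖ ≤ r →
      ‖Complex.exp z - ∑ k ∈ Finset.range m, (k.factorial : ℂ)⁻¹ * z ^ k‖ ≤ ε := by
  have h := tendstoUniformlyOn_tsum_nat (f := fun k (z : ℂ) => (k.factorial : ℂ)⁻¹ * z ^ k)
    (Real.summable_pow_div_factorial r) (s := Metric.closedBall 0 r) (fun k z hz => by
      rw [norm_mul, norm_inv, norm_pow, Complex.norm_natCast, inv_mul_eq_div]
      gcongr
      simpa using hz)
  obtain ⟨m, hm⟩ := (Metric.tendstoUniformlyOn_iff.mp h ε hε).exists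
  refine ⟨m, fun z hz => ?_⟩
  have := hm z (by simpa using hz)
  rw [dist_eq_norm] at this
  have e : ∑' k : ℕ, (k.factorial : ℂ)⁻¹ * z ^ k = Complex.exp z := by
    rw [Complex.exp_eq_exp_ℂ, NormedSpace.exp_eq_tsum_div]
    exact tsum_congr fun k => inv_mul_eq_div _ _
  rw [e] at this
  exact this.le

/-- Localization to bounded sets in both position and frequency is compact: its integral kernel
`exp (2πixξ)` is a uniform limit of polynomials in `xξ`, which define operators of finite rank. -/
theorem isCompactOperator_cutoff (a : ℝ) :
    IsCompactOperator (mulCLM (cutoff a) (isBddMul_cutoff a) ∘L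
      fourierMul (cutoff a) (isBddMul_cutoff a)) := by
  set K := mulCLM (cutoff a) (isBddMul_cutoff a) ∘L fourierMul (cutoff a) (isBddMul_cutoff a)
  set F : L2Spinor →L[ℂ] L2Spinor :=
    ((Lp.fourierTransformₗᵢ ℝ Spinor).toContinuousLinearEquiv : L2Spinor →L[ℂ] L2Spinor)
  have hpow : ∀ k : ℕ, Continuous fun v : ℝ => (v : ℂ) ^ k := fun k => by fun_prop
  set φ : ℕ → Lp ℂ 2 (volume : Measure ℝ) := fun k => truncL2 a (hpow k) with hφ
  set c : ℕ → ℂ := fun k => (k.factorial : ℂ)⁻¹ * (2 * Real.pi * Complex.I) ^ k with hc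
  set S : ℕ → L2Spinor →L[ℂ] L2Spinor := fun m => ∑ k ∈ Finset.range m,
    c k • (tensorL2 (φ k) ∘L pairL2.flip (φ k) ∘L F) with hS
  have hScomp : ∀ m, S m ∈ {T : L2Spinor →L[ℂ] L2Spinor | IsCompactOperator T} := fun m => by
    have hT : ∀ k, tensorL2 (φ k) ∘L pairL2.flip (φ k) ∘L F ∈
        compactOperator (RingHom.id ℂ) L2Spinor L2Spinor := fun k =>
      (isCompactOperator_of_locallyCompactSpace_rng (tensorL2 (φ k))).comp_clm
        (pairL2.flip (φ k) ∘L F)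
    exact (compactOperator (RingHom.id ℂ) L2Spinor L2Spinor).sum_mem fun k _ =>
      Submodule.smul_mem _ _ (hT k)
  have hKcl : K ∈ closure {T : L2Spinor →L[ℂ] L2Spinor | IsCompactOperator T} := by
    refine Metric.mem_closure_iff.mpr fun ε hε => ?_
    have hfin : volume (Set.Icc (-a) a) ≠ ⊤ := measure_Icc_lt_top.ne
    set M : ℝ := ‖indicatorConstLp 2 (measurableSet_Icc (a := -a) (b := a)) hfin (1 : ℝ)‖ with hM
    set δ : ℝ := ε / (2 * (‖pairL2‖ * M * M + 1)) with hδ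
    have hδ0 : 0 < δ := by positivity
    obtain ⟨m, hm⟩ := exists_norm_exp_sub_sum_le (2 * Real.pi * (a * a)) hδ0
    refine ⟨S m, hScomp m, ?_⟩
    rw [dist_eq_norm]
    have hbound : ‖K - S m‖ ≤ ‖pairL2‖ * (δ * M) * M := by
      refine ContinuousLinearMap.opNorm_le_bound _ (by positivity) fun f => ?_
      set g : L2Spinor := 𝓕 f with hg
      have hgn : ‖g‖ = ‖f‖ := Lp.norm_fourier_eq f
      -- The kernel of `K - S m`, as an `L²` function of the frequency.
      have hker : ∀ x ∈ Set.Icc (-a) a, ‖truncL2 a (continuous_fourierKernel x) -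
          ∑ k ∈ Finset.range m, (c k * (x : ℂ) ^ k) • φ k‖ ≤ δ * M := fun x hx => by
        refine Lp.norm_le_mul_norm_of_ae_le_mul ?_
        have h2 : ∀ᵐ v : ℝ, ∀ k, φ k v = (Set.Icc (-a) a).indicator (fun v : ℝ => (v : ℂ) ^ k) v :=
          ae_all_iff.mpr fun k => coeFn_truncL2 a (hpow k)
        have h3 : ∀ᵐ v : ℝ, ∀ k, ((c k * (x : ℂ) ^ k) • φ k : Lp ℂ 2 (volume : Measure ℝ)) v =
            (c k * (x : ℂ) ^ k) • φ k v := ae_all_iff.mpr fun k => Lp.coeFn_smul _ _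
        filter_upwards [coeFn_truncL2 a (continuous_fourierKernel x), h2, h3,
          Lp.coeFn_sub (truncL2 a (continuous_fourierKernel x))
            (∑ k ∈ Finset.range m, (c k * (x : ℂ) ^ k) • φ k),
          Lp.coeFn_fun_finsetSum (Finset.range m) (fun k => (c k * (x : ℂ) ^ k) • φ k),
          indicatorConstLp_coeFn (p := 2) (hs := measurableSet_Icc (a := -a) (b := a))
            (hμs := hfin) (c := (1 : ℝ))] with v e1 e2 e3 e4 e5 e6
        rw [e4, Pi.sub_apply, e1, e5, e6]
        simp only [e3, e2]
        by_cases hv : v ∈ Set.Icc (-a) a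
        · simp only [Set.indicator_of_mem hv]
          rw [norm_one, mul_one]
          have hz : ‖2 * Real.pi * Complex.I * ((x : ℂ) * v)‖ ≤ 2 * Real.pi * (a * a) := by
            have : ‖2 * Real.pi * Complex.I * ((x : ℂ) * v)‖ = 2 * Real.pi * (|x| * |v|) := by
              simp [abs_of_pos Real.pi_pos]
            rw [this]
            have hxa : |x| ≤ a := abs_le.mpr hx
            have hva : |v| ≤ a := abs_le.mpr hv
            have := (abs_nonneg x).trans hxa
            gcongr
          refine le_trans (le_of_eq ?_) (hm _ hz)
          congr 2
          refine Finset.sum_congr rfl fun k _ => ?_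
          rw [hc, smul_eq_mul]
          ring
        · simp [Set.indicator_of_notMem hv]
      have hpt : ∀ᵐ x : ℝ, ‖((K - S m) f : L2Spinor) x‖ ≤ (‖pairL2‖ * ‖f‖ * (δ * M)) *
          ‖indicatorConstLp 2 (measurableSet_Icc (a := -a) (b := a)) hfin (1 : ℝ) x‖ := by
        have hSf : S m f = ∑ k ∈ Finset.range m, c k • tensorL2 (φ k) (pairL2 g (φ k)) := by
          rw [hS]
          simp only [sum_apply, smul_apply]
          rfl
        have h1 : ∀ᵐ x : ℝ, ∀ k, (c k • tensorL2 (φ k) (pairL2 g (φ k)) : L2Spinor) x =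
            c k • tensorL2 (φ k) (pairL2 g (φ k)) x := ae_all_iff.mpr fun k => Lp.coeFn_smul _ _
        have h2 : ∀ᵐ x : ℝ, ∀ k, tensorL2 (φ k) (pairL2 g (φ k)) x =
            φ k x • pairL2 g (φ k) := ae_all_iff.mpr fun k => coeFn_tensorL2 _ _
        have h3 : ∀ᵐ v : ℝ, ∀ k, φ k v = (Set.Icc (-a) a).indicator (fun v : ℝ => (v : ℂ) ^ k) v :=
          ae_all_iff.mpr fun k => coeFn_truncL2 a (hpow k)
        rw [sub_apply, hSf]
        filter_upwards [h1, h2, h3, Lp.coeFn_sub (K f)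
            (∑ k ∈ Finset.range m, c k • tensorL2 (φ k) (pairL2 g (φ k))),
          Lp.coeFn_fun_finsetSum (Finset.range m)
            (fun k => c k • tensorL2 (φ k) (pairL2 g (φ k))),
          coeFn_mulCLM (isBddMul_cutoff a) (fourierMul (cutoff a) (isBddMul_cutoff a) f),
          coeFn_fourierMul_cutoff a f,
          indicatorConstLp_coeFn (p := 2) (hs := measurableSet_Icc (a := -a) (b := a))
            (hμs := hfin) (c := (1 : ℝ))] with x e1 e2 e3 e4 e5 e6 e7 e8
        have e9 : (K f : L2Spinor) x =
            cutoff a x (pairL2 g (truncL2 a (continuous_fourierKernel x))) := by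
          rw [← e7]
          exact e6
        rw [e4, Pi.sub_apply, e9, e5, e8]
        simp only [e1, e2, e3]
        by_cases hx : x ∈ Set.Icc (-a) a
        · simp only [cutoff, Set.indicator_of_mem hx]
          rw [norm_one, mul_one, one_apply_eq_self]
          have e10 : ∑ k ∈ Finset.range m, c k • (x : ℂ) ^ k • pairL2 g (φ k) =
              pairL2 g (∑ k ∈ Finset.range m, (c k * (x : ℂ) ^ k) • φ k) := by
            rw [map_sum]
            refine Finset.sum_congr rfl fun k _ => ?_
            rw [map_smul, smul_smul]
          rw [e10, ← map_sub]
          refine (pairL2.le_opNorm₂ _ _).trans ?_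
          rw [hgn]
          gcongr
          exact hker x hx
        · simp [cutoff, Set.indicator_of_notMem hx]
      refine (Lp.norm_le_mul_norm_of_ae_le_mul hpt).trans (le_of_eq ?_)
      ring
    refine hbound.trans_lt ?_
    have : ‖pairL2‖ * (δ * M) * M = ε / 2 * (‖pairL2‖ * M * M / (‖pairL2‖ * M * M + 1)) := by
      rw [hδ]
      field_simp
    rw [this]
    have h1 : ‖pairL2‖ * M * M / (‖pairL2‖ * M * M + 1) ≤ 1 := by
      rw [div_le_one (by positivity)]
      linarith
    nlinarith
  exact isClosed_setOfPred_isCompactOperator.closure_subset hKcl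

/-- Cutting off a field that vanishes at infinity converges in operator norm. -/
theorem exists_forall_norm_sub_cutoff_le {A : ℝ → Spinor →L[ℂ] Spinor}
    (h0 : Filter.Tendsto A (Filter.cocompact ℝ) (𝓝 0)) {ε : ℝ} (hε : 0 < ε) :
    ∃ N : ℕ, ∀ n : ℕ, N ≤ n → ∀ x, x ∉ Set.Icc (-(n : ℝ)) n → ‖A x‖ ≤ ε := by
  have h1 : ∀ᶠ x in Filter.cocompact ℝ, ‖A x‖ < ε :=
    (NormedAddGroup.tendsto_nhds_zero.mp h0) ε hε
  obtain ⟨t, ht, hts⟩ := Filter.mem_cocompact.mp h1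
  obtain ⟨r, hr⟩ := ht.isBounded.subset_closedBall 0
  obtain ⟨N, hN⟩ := exists_nat_ge r
  refine ⟨N, fun n hn x hx => ?_⟩
  have hxt : x ∈ tᶜ := fun hxt => by
    have := hr hxt
    rw [mem_closedBall_zero_iff, Real.norm_eq_abs] at this
    exact hx (abs_le.mp (this.trans (hN.trans (by exact_mod_cast hn))))
  exact (hts hxt).le

theorem tendsto_mulCLM_comp_cutoff {A : ℝ → Spinor →L[ℂ] Spinor} (hA : IsBddMul A)
    (h0 : Filter.Tendsto A (Filter.cocompact ℝ) (𝓝 0)) :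
    Filter.Tendsto (fun n : ℕ => mulCLM A hA ∘L mulCLM (cutoff n) (isBddMul_cutoff n))
      Filter.atTop (𝓝 (mulCLM A hA)) := by
  refine Metric.tendsto_atTop'.mpr fun ε hε => ?_
  obtain ⟨N, hN⟩ := exists_forall_norm_sub_cutoff_le h0 (half_pos hε)
  refine ⟨N, fun n hn => ?_⟩
  rw [dist_eq_norm, ← mulCLM_comp, ← mulCLM_sub (hA.comp (isBddMul_cutoff n)) hA]
  refine (norm_mulCLM_le _ (half_pos hε).le fun x => ?_).trans_lt (half_lt_self hε)
  by_cases hx : x ∈ Set.Icc (-(n : ℝ)) n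
  · rw [cutoff, Set.indicator_of_mem hx, ContinuousLinearMap.one_def, ContinuousLinearMap.comp_id,
      sub_self, norm_zero]
    exact (half_pos hε).le
  · rw [cutoff, Set.indicator_of_notMem hx, ContinuousLinearMap.comp_zero, zero_sub, norm_neg]
    exact hN n hn.le x hx

theorem tendsto_cutoff_comp_mulCLM {A : ℝ → Spinor →L[ℂ] Spinor} (hA : IsBddMul A)
    (h0 : Filter.Tendsto A (Filter.cocompact ℝ) (𝓝 0)) :
    Filter.Tendsto (fun n : ℕ => mulCLM (cutoff n) (isBddMul_cutoff n) ∘L mulCLM A hA)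
      Filter.atTop (𝓝 (mulCLM A hA)) := by
  refine Metric.tendsto_atTop'.mpr fun ε hε => ?_
  obtain ⟨N, hN⟩ := exists_forall_norm_sub_cutoff_le h0 (half_pos hε)
  refine ⟨N, fun n hn => ?_⟩
  rw [dist_eq_norm, ← mulCLM_comp, ← mulCLM_sub ((isBddMul_cutoff n).comp hA) hA]
  refine (norm_mulCLM_le _ (half_pos hε).le fun x => ?_).trans_lt (half_lt_self hε)
  by_cases hx : x ∈ Set.Icc (-(n : ℝ)) n
  · rw [cutoff, Set.indicator_of_mem hx, ContinuousLinearMap.one_def, ContinuousLinearMap.id_comp,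
      sub_self, norm_zero]
    exact (half_pos hε).le
  · rw [cutoff, Set.indicator_of_notMem hx, ContinuousLinearMap.zero_comp, zero_sub, norm_neg]
    exact hN n hn.le x hx

/-- If both `A` and `B` vanish at infinity, then `A(x) B(D)` is compact. -/
theorem isCompactOperator_mulCLM_comp_fourierMul {A B : ℝ → Spinor →L[ℂ] Spinor}
    (hA : IsBddMul A) (hB : IsBddMul B) (hA0 : Filter.Tendsto A (Filter.cocompact ℝ) (𝓝 0))
    (hB0 : Filter.Tendsto B (Filter.cocompact ℝ) (𝓝 0)) :
    IsCompactOperator (mulCLM A hA ∘L fourierMul B hB) := by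
  have h1 := tendsto_mulCLM_comp_cutoff hA hA0
  have h2 := tendsto_cutoff_comp_mulCLM hB hB0
  set F : L2Spinor →L[ℂ] L2Spinor :=
    ((Lp.fourierTransformₗᵢ ℝ Spinor).toContinuousLinearEquiv : L2Spinor →L[ℂ] L2Spinor) with hF
  set G : L2Spinor →L[ℂ] L2Spinor :=
    ((Lp.fourierTransformₗᵢ ℝ Spinor).symm.toContinuousLinearEquiv : L2Spinor →L[ℂ] L2Spinor)
    with hG
  have h3 := h1.mul ((tendsto_const_nhds (x := G)).mul (h2.mul (tendsto_const_nhds (x := F))))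
  refine isCompactOperator_of_tendsto h3 (.of_forall fun n => ?_)
  have h4 := ((isCompactOperator_cutoff n).comp_clm (fourierMul B hB)).clm_comp (mulCLM A hA)
  refine (congrArg IsCompactOperator (funext fun f => ?_)).mp h4
  change mulCLM A hA (mulCLM (cutoff n) (isBddMul_cutoff n) (G (mulCLM (cutoff n)
    (isBddMul_cutoff n) (F (G (mulCLM B hB (F f))))))) = mulCLM A hA (mulCLM (cutoff n)
    (isBddMul_cutoff n) (G (mulCLM (cutoff n) (isBddMul_cutoff n) (mulCLM B hB (F f)))))
  congr 4
  exact (Lp.fourierTransformₗᵢ ℝ Spinor).apply_symm_apply _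

theorem tendsto_resolventSymbol {s : ℂ} (hs : s ^ 2 ∉ Complex.ofReal '' Set.Ici 1) :
    Filter.Tendsto (resolventSymbol s) (Filter.cocompact ℝ) (𝓝 0) := by
  obtain ⟨C, hC0, hC⟩ := exists_norm_resolventSymbol_le hs
  have hlim : Filter.Tendsto (fun ξ : ℝ => C / ‖ξ‖) (Filter.cocompact ℝ) (𝓝 0) :=
    (tendsto_norm_cocompact_atTop (E := ℝ)).const_div_atTop C
  refine squeeze_zero_norm' ?_ hlim
  have hne : ∀ᶠ ξ : ℝ in Filter.cocompact ℝ, 0 < ‖ξ‖ :=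
    tendsto_norm_cocompact_atTop.eventually_gt_atTop 0
  filter_upwards [hne] with ξ hξ
  rw [le_div_iff₀ hξ, mul_comm]
  refine le_trans ?_ (hC ξ)
  gcongr
  rw [Real.norm_eq_abs]
  nlinarith [abs_nonneg ξ, Real.pi_gt_three]

/-- Potentials vanishing at infinity are compact relative to the free Dirac operator. -/
theorem isRelCompact_freeOperator (ω : ℝ) {A : ℝ → Spinor →L[ℂ] Spinor} (hA : IsBddMul A)
    (hA0 : Filter.Tendsto A (Filter.cocompact ℝ) (𝓝 0)) :
    IsRelCompact (freeOperator ω) (mulCLM A hA) := by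
  intro R B hRB
  -- The free resolvent at `z = i - ω`, where `(z + ω)² = -1`, serves as a reference.
  have hs : ((Complex.I - ω) + ω) ^ 2 ∉ Complex.ofReal '' Set.Ici 1 := by
    rw [sub_add_cancel, Complex.I_sq]
    rintro ⟨r, hr, h⟩
    have h1 : r = -1 := by exact_mod_cast h
    have h2 : (1 : ℝ) ≤ r := hr
    linarith
  have h1 := isCompactOperator_mulCLM_comp_fourierMul hA (isBddMul_resolventSymbol hs) hA0
    (tendsto_resolventSymbol hs)
  have h2 := h1.comp_clm (B - (Complex.I - ω) • R)
  refine (congrArg IsCompactOperator (funext fun f => ?_)).mp h2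
  obtain ⟨h3, h4⟩ := hRB f
  have h5 := (freeResolvent_spec ω hs).2 ⟨R f, h3⟩
  rw [h4] at h5
  exact congrArg (mulCLM A hA) h5

/-! ### Potentials with a limit at infinity -/

theorem continuous_matCLM : Continuous fun M : Matrix (Fin 2) (Fin 2) ℂ => matCLM M :=
  LinearMap.continuous_of_finiteDimensional
    (Matrix.toEuclideanCLM (n := Fin 2) (𝕜 := ℂ)).toAlgEquiv.toLinearMap

theorem IsBddMul.of_continuous_of_tendsto {A : ℝ → Spinor →L[ℂ] Spinor} (hA : Continuous A)
    {L : Spinor →L[ℂ] Spinor} (hL : Filter.Tendsto A (Filter.cocompact ℝ) (𝓝 L)) :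
    IsBddMul A := by
  refine ⟨hA.aestronglyMeasurable, ?_⟩
  have h1 : ∀ᶠ x in Filter.cocompact ℝ, ‖A x‖ < ‖L‖ + 1 :=
    hL.norm.eventually_lt_const (lt_add_one _)
  obtain ⟨t, ht, hts⟩ := Filter.mem_cocompact.mp h1
  obtain ⟨C, hC⟩ := ht.exists_bound_of_continuousOn hA.continuousOn
  refine ⟨max C (‖L‖ + 1), le_max_of_le_right (by positivity), fun x => ?_⟩
  by_cases hx : x ∈ t
  · exact le_max_of_le_left (hC x hx)
  · exact le_max_of_le_right (le_of_lt (hts hx))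

/-- The essential spectrum of a Dirac operator is determined by the limit of its potential. -/
theorem essentialSpectrum_operator (ω : ℝ) {V : ℝ → Matrix (Fin 2) (Fin 2) ℂ} (hc : Continuous V)
    (hH : ∀ x, (V x).IsHermitian) (hlim : Filter.Tendsto V (Filter.cocompact ℝ) (𝓝 (Vlim ω))) :
    essentialSpectrum (operator V) =
      Complex.ofReal '' (Set.univ \ Set.Ioo (-(1 + ω)) (1 - ω)) := by
  have hlim' : Filter.Tendsto (fun x => matCLM (V x)) (Filter.cocompact ℝ)
      (𝓝 (matCLM (Vlim ω))) := (continuous_matCLM.tendsto _).comp hlim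
  have hV : IsBddMul fun x => matCLM (V x) :=
    .of_continuous_of_tendsto (continuous_matCLM.comp hc) hlim'
  have hW := hV.sub (isBddMul_Vlim ω)
  have hW0 : Filter.Tendsto (fun x => matCLM (V x) - matCLM (Vlim ω)) (Filter.cocompact ℝ)
      (𝓝 0) := by
    simpa using hlim'.sub (tendsto_const_nhds (x := matCLM (Vlim ω)))
  have hpert : IsBoundedPerturbation (freeOperator ω) (operator V) (mulCLM _ hW) :=
    { domain_eq := (operator_domain hV).trans (operator_domain (isBddMul_Vlim ω)).symm
      apply_eq := fun ψ h h₀ => by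
        have h' : ψ ∈ sobolevH1 := operator_domain hV ▸ h
        rw [operator_apply hV ψ h h', operator_apply (isBddMul_Vlim ω) ψ h₀ h',
          mulCLM_sub hV (isBddMul_Vlim ω), sub_apply]
        abel }
  rw [essentialSpectrum_eq_spectrum hpert (isRelCompact_freeOperator ω hW hW0)
    (isSymm_operator hV hH) (eigenspace_freeOperator ω) (isClosed_spectrum_freeOperator ω)
    (preperfect_spectrum_freeOperator ω), spectrum_freeOperator]

/-! ### Solitary waves -/

/-- A continuous representative of an `H¹` function vanishes at infinity, by the Riemann–Lebesgue
lemma for its integrable Fourier transform. -/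
theorem tendsto_zero_of_mem_sobolevH1 {f : ℝ → Spinor} (hf : Continuous f)
    (h : MemLp f 2 volume) (hmem : h.toLp ∈ sobolevH1) :
    Filter.Tendsto f (Filter.cocompact ℝ) (𝓝 0) := by
  have hs : MemSobolev 1 2 ((h.toLp : L2Spinor) : 𝓢'(ℝ, Spinor)) := hmem
  obtain ⟨w, hw⟩ := hs.fourier_memL1 (by simp)
  have hwi : Integrable w := L1.integrable_coeFn w
  have h1 : (𝓕 (h.toLp : L2Spinor) : L2Spinor) =ᵐ[volume] w := by
    refine ae_eq_of_forall_schwartz ((Lp.memLp _).locallyIntegrable one_le_two)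
      hwi.locallyIntegrable fun g => ?_
    rw [← Lp.toTemperedDistribution_apply, ← Lp.toTemperedDistribution_apply, ← hw,
      Lp.fourier_toTemperedDistribution_eq]
  have h2 := ae_eq_fourierInv hwi h1
  have hcont : Continuous (𝓕⁻ (w : ℝ → Spinor) : ℝ → Spinor) := by
    rw [← Real.Lp.coe_fourierTransformInv]
    exact (Real.Lp.fourierTransformInv w).continuous
  have h3 : f = (𝓕⁻ (w : ℝ → Spinor) : ℝ → Spinor) :=
    (hf.ae_eq_iff_eq volume hcont).mp (h.coeFn_toLp.symm.trans h2)
  have h4 : (𝓕⁻ (w : ℝ → Spinor) : ℝ → Spinor) = fun x => 𝓕 (w : ℝ → Spinor) (-x) :=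
    funext fun x => Real.fourierInv_eq_fourier_neg _ x
  rw [h3, h4]
  exact (Real.zero_at_infty_fourier (w : ℝ → Spinor)).comp
    (Homeomorph.neg ℝ).isClosedEmbedding.tendsto_cocompact

namespace IsSolitaryWave

variable {g : ℝ → ℝ} {ω : ℝ} {v u : ℝ → ℝ}

theorem tendsto_zero (hφ : IsSolitaryWave g ω v u) :
    Filter.Tendsto v (Filter.cocompact ℝ) (𝓝 0) ∧ Filter.Tendsto u (Filter.cocompact ℝ) (𝓝 0) := by
  obtain ⟨h, hmem⟩ := hφ.memH1
  have hv := hφ.differentiable_v.continuous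
  have hu := hφ.differentiable_u.continuous
  have hc : Continuous fun x => (!₂[(v x : ℂ), (u x : ℂ)] : Spinor) := by
    refine (PiLp.continuous_toLp 2 _).comp (continuous_pi fun i => ?_)
    fin_cases i
    · exact Complex.continuous_ofReal.comp hv
    · exact Complex.continuous_ofReal.comp hu
  have h0 := (tendsto_zero_of_mem_sobolevH1 hc h hmem).norm
  rw [norm_zero] at h0
  refine ⟨squeeze_zero_norm (fun x => ?_) h0, squeeze_zero_norm (fun x => ?_) h0⟩
  · simpa using PiLp.norm_apply_le (!₂[(v x : ℂ), (u x : ℂ)] : Spinor) 0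
  · simpa using PiLp.norm_apply_le (!₂[(v x : ℂ), (u x : ℂ)] : Spinor) 1

theorem continuous_Vminus (hφ : IsSolitaryWave g ω v u) (hg : Continuous g) :
    Continuous (Vminus g ω v u) := by
  have hv := hφ.differentiable_v.continuous
  have hu := hφ.differentiable_u.continuous
  refine continuous_matrix fun i j => ?_
  fin_cases i <;> fin_cases j <;> simp [Vminus] <;> fun_prop

theorem continuous_Vplus (hφ : IsSolitaryWave g ω v u) (hg : Continuous g)
    (hg' : Continuous (deriv g)) : Continuous (Vplus g ω v u) := by
  have hv := hφ.differentiable_v.continuous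
  have hu := hφ.differentiable_u.continuous
  refine continuous_matrix fun i j => ?_
  fin_cases i <;> fin_cases j <;> simp [Vplus] <;> fun_prop

/-- The potentials depend continuously on the values of the wave, which tend to zero. -/
theorem tendsto_Vminus (hφ : IsSolitaryWave g ω v u) (hg : Continuous g) (hg0 : g 0 = 1) :
    Filter.Tendsto (Vminus g ω v u) (Filter.cocompact ℝ) (𝓝 (Vlim ω)) := by
  obtain ⟨hv, hu⟩ := hφ.tendsto_zero
  have hΦ : Continuous fun p : ℝ × ℝ => Vminus g ω (fun _ => p.1) (fun _ => p.2) 0 := by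
    refine continuous_matrix fun i j => ?_
    fin_cases i <;> fin_cases j <;> simp [Vminus] <;> fun_prop
  have h := (hΦ.tendsto (0, 0)).comp (hv.prodMk_nhds hu)
  have e : Vminus g ω (fun _ => (0, 0).1) (fun _ => (0, 0).2) 0 = Vlim ω := by
    ext i j
    fin_cases i <;> fin_cases j <;> simp [Vminus, Vlim, hg0]
    ring
  rw [e] at h
  exact h

theorem tendsto_Vplus (hφ : IsSolitaryWave g ω v u) (hg : Continuous g)
    (hg' : Continuous (deriv g)) (hg0 : g 0 = 1) :
    Filter.Tendsto (Vplus g ω v u) (Filter.cocompact ℝ) (𝓝 (Vlim ω)) := by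
  obtain ⟨hv, hu⟩ := hφ.tendsto_zero
  have hΦ : Continuous fun p : ℝ × ℝ => Vplus g ω (fun _ => p.1) (fun _ => p.2) 0 := by
    refine continuous_matrix fun i j => ?_
    fin_cases i <;> fin_cases j <;> simp [Vplus] <;> fun_prop
  have h := (hΦ.tendsto (0, 0)).comp (hv.prodMk_nhds hu)
  have e : Vplus g ω (fun _ => (0, 0).1) (fun _ => (0, 0).2) 0 = Vlim ω := by
    ext i j
    fin_cases i <;> fin_cases j <;> simp [Vplus, Vlim, hg0]
    ring
  rw [e] at h
  exact h

end IsSolitaryWave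

theorem isHermitian_Vminus (g : ℝ → ℝ) (ω : ℝ) (v u : ℝ → ℝ) (x : ℝ) :
    (Vminus g ω v u x).IsHermitian := by
  ext i j
  fin_cases i <;> fin_cases j <;> simp [Vminus]

theorem isHermitian_Vplus (g : ℝ → ℝ) (ω : ℝ) (v u : ℝ → ℝ) (x : ℝ) :
    (Vplus g ω v u x).IsHermitian := by
  ext i j
  fin_cases i <;> fin_cases j <;> simp [Vplus]

theorem symbol_zero (V : ℝ → Matrix (Fin 2) (Fin 2) ℂ) : (fun x => symbol V x 0) = V := by
  funext x
  simp [symbol]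

theorem spectrum_Vlim (ω : ℝ) :
    _root_.spectrum ℂ (Vlim ω) = {((-(1 + ω) : ℝ) : ℂ), ((1 - ω : ℝ) : ℂ)} := by
  have e : Vlim ω = Matrix.diagonal ![((1 - ω : ℝ) : ℂ), ((-(1 + ω) : ℝ) : ℂ)] := by
    ext i j
    fin_cases i <;> fin_cases j <;> simp [Vlim]
  rw [e, spectrum_diagonal, Matrix.range_cons, Matrix.range_cons, Matrix.range_empty,
    Set.union_empty, Set.union_comm]
  rfl

end

end Dirac

theorem mainTheorem5 (g : ℝ → ℝ) (hg : ContDiff ℝ (⊤ : ℕ∞) g) (hg0 : g 0 = 1)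
    (ω : ℝ) (v u : ℝ → ℝ) (hφ : Dirac.IsSolitaryWave g ω v u) :
    UnboundedOperator.essentialSpectrum (Dirac.Hplus g ω v u) =
        Complex.ofReal '' (Set.univ \ Set.Ioo (-(1 + ω)) (1 - ω)) ∧
      UnboundedOperator.essentialSpectrum (Dirac.Hminus g ω v u) =
        Complex.ofReal '' (Set.univ \ Set.Ioo (-(1 + ω)) (1 - ω)) ∧
      ∃ S : Matrix (Fin 2) (Fin 2) ℂ,
        S = !![((1 - ω : ℝ) : ℂ), 0; 0, ((-(1 + ω) : ℝ) : ℂ)] ∧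
        Filter.Tendsto (fun x => Dirac.symbol (Dirac.Vplus g ω v u) x 0)
          (Filter.cocompact ℝ) (𝓝 S) ∧
        Filter.Tendsto (fun x => Dirac.symbol (Dirac.Vminus g ω v u) x 0)
          (Filter.cocompact ℝ) (𝓝 S) ∧
        spectrum ℂ S = {((-(1 + ω) : ℝ) : ℂ), ((1 - ω : ℝ) : ℂ)} := by
  have hgc : Continuous g := hg.continuous
  have hgc' : Continuous (deriv g) := hg.continuous_deriv (by simp)
  have hp := hφ.tendsto_Vplus hgc hgc' hg0
  have hm := hφ.tendsto_Vminus hgc hg0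
  refine ⟨Dirac.essentialSpectrum_operator ω (hφ.continuous_Vplus hgc hgc')
      (Dirac.isHermitian_Vplus g ω v u) hp,
    Dirac.essentialSpectrum_operator ω (hφ.continuous_Vminus hgc)
      (Dirac.isHermitian_Vminus g ω v u) hm,
    Dirac.Vlim ω, rfl, ?_, ?_, Dirac.spectrum_Vlim ω⟩
  · rw [Dirac.symbol_zero]
    exact hp
  · rw [Dirac.symbol_zero]
    exact hm
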